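/- For $\tau$ in the upper half-plane $\mathcal H=\{\tau\in\mathbb C:\operatorname{Im}\tau>0\}$ put $q=e^{2\pi i\tau}$, let $\eta(\tau)=e^{2\pi i\tau/24}\prod_{j=1}^{\infty}(1-q^{j})$ be the Dedekind eta function and $\eta_l(\tau)=\eta(l\tau)$ for integers $l\ge 1$. Let $$t_\Gamma=\frac{\eta_3\,\eta_{13}}{\eta_1\,\eta_{39}},\qquad x(\tau)=\frac{1}{t_\Gamma(\tau)}$$ (the eta quotient attached to the Moonshine group $\Gamma=39+39$; the group itself plays no further role in the statement), and $$\Psi_2(X,Y)=Y^3+(2X-X^2)Y^2+(-X+2X^2)Y+X^3 .$$ Then $t_\Gamma=\frac1q+O(1)$ as $\operatorname{Im}\tau\to\infty$, and for every $\tau\in\mathcal H$ the following identity of polynomials in $Y$ holds: $$\Psi_2(x(\tau),Y)=\bigl(Y-x(2\tau)\bigr)\Bigl(Y-x\bigl(\tfrac{\tau}{2}\bigr)\Bigr)\Bigl(Y-x\bigl(\tfrac{\tau+1}{2}\bigr)\Bigr).$$ Moreover, with $t_1=t_\Gamma(2\tau)$, $t_2=t_\Gamma(\tfrac{\tau}{2})$,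 $t_3=t_\Gamma(\tfrac{\tau+1}{2})$ and $t_\Gamma=t_\Gamma(\tau)$, $$t_1+t_2+t_3=t_\Gamma^2-2t_\Gamma,\qquad t_1t_2+t_1t_3+t_2t_3=2t_\Gamma^2-t_\Gamma,\qquad t_1t_2t_3=-t_\Gamma^3 .$$ -/

import Mathlib

open Polynomial Asymptotics

/-- `η_l(τ) = η(lτ)`, where `η(τ) = e^{2πiτ/24} ∏_{j ≥ 1} (1 - q^j)`, `q = e^{2πiτ}`, is Mathlib's
Dedekind eta function. -/
noncomputable def etaScaled (l : ℕ) (τ : ℂ) : ℂ :=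
  ModularForm.eta ((l : ℂ) * τ)

/-- The eta quotient `t_Γ = η_3 η_13 / (η_1 η_39)` attached to the Moonshine group `Γ = 39+39`
(meaningful for `τ` in the upper half-plane, where `η` does not vanish). -/
noncomputable def tGamma (τ : ℂ) : ℂ :=
  (etaScaled 3 τ * etaScaled 13 τ) / (etaScaled 1 τ * etaScaled 39 τ)

/-- `x = 1 / t_Γ`. -/
noncomputable def xGamma (τ : ℂ) : ℂ :=
  1 / tGamma τ

/-- `Ψ_2(X, Y) = Y³ + (2X - X²) Y² + (-X + 2X²) Y + X³`, as a polynomial in `Y` (the outer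
variable) with coefficients in `ℂ[X]`. -/
noncomputable def Psi2 : ℂ[X][X] :=
  X ^ 3 + C (2 * X - X ^ 2) * X ^ 2 + C (-X + 2 * X ^ 2) * X + C (X ^ 3)

/-- On the upper half-plane the eta quotient is finite and nonzero, so that the two
divisions above are genuine. -/
theorem tGamma_ne_zero {τ : ℂ} (hτ : 0 < τ.im) :
    etaScaled 1 τ * etaScaled 39 τ ≠ 0 ∧ tGamma τ ≠ 0 := by
  have h : ∀ l : ℕ, 0 < l → etaScaled l τ ≠ 0 := fun l hl =>
    ModularForm.eta_ne_zero (by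
      have : (0 : ℝ) < (l : ℝ) * τ.im := by positivity
      simpa [UpperHalfPlane.upperHalfPlaneSet] using this)
  have h0 := mul_ne_zero (h 1 (by norm_num)) (h 39 (by norm_num))
  exact ⟨h0, div_ne_zero (mul_ne_zero (h 3 (by norm_num)) (h 13 (by norm_num))) h0⟩

/-! Write t for `tGamma`. The core is a symmetric cubic relation between t(τ) and t(2τ),
`modularPoly`, which is Ψ_2(1/t, 1/s) cleared of denominators.

One has t(τ) = r(τ)/r(3τ) with r(τ) = η(13τ)/η(τ), and r transforms under Γ₀(13) by an explicit sign
(`etaRatio_mobius`). These signs cancel in t, so every Atkin-Lehner map of level 39 fixes or inverts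
t (`tGamma_atkinLehner`). Hence `modularDefect`, a normalized square of the cubic at (t(τ), t(2τ)),
is invariant under all Atkin-Lehner maps of level 78. Since 78 is squarefree, these carry every cusp
to ∞, so only ∞ has to be examined, and there t = 1/q + 1 + O(q) already makes the defect vanish.
Compactness enters through Dirichlet approximation: every point can be moved to height at least
1/320 (`exists_modularDefect_eq_im_ge`). The maximum principle in q then makes the defect constant,
hence zero (`modularDefect_eq_zero`).

The product of the three conjugates t(2τ), t(τ/2), t((τ+1)/2) comes from Euler products
(`tGamma_mul_mul`). The first two are roots of the cubic and generically distinct, so the product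
determines the sum (`tGamma_sum`), and the cubic then yields the second symmetric function. Passing
to reciprocals gives Ψ_2. -/

/-! ### Möbius maps and the transformation of η^24. -/

theorem mobius_denom_ne_zero {a b c d : ℤ} (h : 0 < a * d - b * c) {τ : ℂ} (hτ : 0 < τ.im) :
    (c : ℂ) * τ + d ≠ 0 := by
  intro h0
  have him := congrArg Complex.im h0
  have hre := congrArg Complex.re h0
  simp at him hre
  rcases him with hc | hc
  · subst hc
    simp at hre
    subst hre
    simp at h
  · exact hτ.ne' hc

theorem mobius_im (a b c d : ℤ) (τ : ℂ) :
    (((a : ℂ) * τ + b) / ((c : ℂ) * τ + d)).im =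
      ((a * d - b * c : ℤ) : ℝ) * τ.im / Complex.normSq ((c : ℂ) * τ + d) := by
  rw [Complex.div_im]
  simp
  ring

theorem mobius_im_pos {a b c d : ℤ} (h : 0 < a * d - b * c) {τ : ℂ} (hτ : 0 < τ.im) :
    0 < (((a : ℂ) * τ + b) / ((c : ℂ) * τ + d)).im := by
  rw [mobius_im]
  have := Complex.normSq_pos.2 (mobius_denom_ne_zero h hτ)
  have h' : (0 : ℝ) < ((a * d - b * c : ℤ) : ℝ) := by exact_mod_cast h
  positivity

theorem eta_ne_zero_of_im_pos {τ : ℂ} (hτ : 0 < τ.im) : ModularForm.eta τ ≠ 0 :=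
  ModularForm.eta_ne_zero hτ

/-- The discriminant η^24 has weight 12 for S and T, which generate SL₂(ℤ). Working with 24th powers
avoids the multiplier system of η; the lost root of unity is recovered later by continuity. -/
theorem eta_mobius_pow {a b c d : ℤ} (h : a * d - b * c = 1) {τ : ℂ} (hτ : 0 < τ.im) :
    ModularForm.eta (((a : ℂ) * τ + b) / ((c : ℂ) * τ + d)) ^ 24 =
      ((c : ℂ) * τ + d) ^ 12 * ModularForm.eta τ ^ 24 := by
  let γ : Matrix.SpecialLinearGroup (Fin 2) ℤ := ⟨!![a, b; c, d], by simp [Matrix.det_fin_two, h]⟩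
  have h1 := SlashInvariantForm.slash_action_generators_SL2Z ModularForm.discriminant_S_invariant
    ModularForm.discriminant_T_invariant γ
  have h2 := congrFun h1 ⟨τ, hτ⟩
  rw [ModularForm.SL_slash_apply] at h2
  have hd : (c : ℂ) * τ + d ≠ 0 := mobius_denom_ne_zero (a := a) (b := b) (by omega) hτ
  have h3 : UpperHalfPlane.denom γ (⟨τ, hτ⟩ : UpperHalfPlane) = (c : ℂ) * τ + d := by
    rw [ModularGroup.denom_apply]
    simp [γ]
  rw [h3] at h2
  simp only [ModularForm.discriminant] at h2
  rw [UpperHalfPlane.specialLinearGroup_apply] at h2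
  simp [γ] at h2
  rw [← div_eq_mul_inv, div_eq_iff (pow_ne_zero _ hd)] at h2
  rw [h2, mul_comm]

theorem eta_add_int (n : ℤ) (τ : ℂ) :
    ModularForm.eta (τ + n) =
      Complex.exp (2 * Real.pi * Complex.I * n / 24) * ModularForm.eta τ := by
  unfold ModularForm.eta
  have h1 : ∀ k, ModularForm.eta_q k (τ + n) = ModularForm.eta_q k τ := by
    intro k
    simp only [ModularForm.eta_q_eq_pow]
    congr 1
    rw [mul_add, Complex.exp_add, show 2 * (Real.pi : ℂ) * Complex.I * n =
      n * (2 * Real.pi * Complex.I) by ring, Complex.exp_int_mul_two_pi_mul_I, mul_one]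
  simp only [h1]
  rw [← mul_assoc]
  congr 1
  simp only [Function.Periodic.qParam]
  rw [← Complex.exp_add]
  congr 1
  push_cast
  ring

theorem differentiableAt_eta {τ : ℂ} (hτ : 0 < τ.im) : DifferentiableAt ℂ ModularForm.eta τ :=
  ModularForm.differentiableAt_eta_of_mem_upperHalfPlaneSet hτ

/-- A continuous function on the upper half-plane with constant `n`-th power is constant. -/
theorem eq_of_pow_eq_const {f : ℂ → ℂ} {n : ℕ} (hn : 0 < n) {w : ℂ}
    (hf : ∀ τ : ℂ, 0 < τ.im → ContinuousAt f τ) (hw : ∀ τ : ℂ, 0 < τ.im → f τ ^ n = w)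
    {τ τ' : ℂ} (hτ : 0 < τ.im) (hτ' : 0 < τ'.im) : f τ = f τ' := by
  have hS : IsPreconnected {z : ℂ | 0 < z.im} := (convex_halfSpace_im_gt 0).isPreconnected
  have hT : {z : ℂ | z ^ n = w}.Finite := by
    have hp : (Polynomial.X ^ n - Polynomial.C w : ℂ[X]) ≠ 0 :=
      Polynomial.X_pow_sub_C_ne_zero hn w
    refine (Polynomial.finite_setOfPred_isRoot hp).subset ?_
    intro z hz
    simpa [sub_eq_zero] using hz
  exact hS.constant_of_mapsTo (T := {z : ℂ | z ^ n = w}) hT.isDiscrete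
    (fun z hz => (hf z hz).continuousWithinAt) (fun z hz => hw z hz) hτ hτ'

/-! ### The quotient η(13τ)/η(τ) and its multipliers on Γ₀(13). -/

/-- The eta quotient `η(13τ) / η(τ)`. -/
noncomputable def etaRatio (τ : ℂ) : ℂ := ModularForm.eta (13 * τ) / ModularForm.eta τ

theorem im_natCast_mul_pos {n : ℕ} (hn : 0 < n) {τ : ℂ} (hτ : 0 < τ.im) :
    0 < ((n : ℂ) * τ).im := by
  simp only [Complex.mul_im, Complex.natCast_re, Complex.natCast_im, zero_mul, add_zero]
  positivity

theorem etaRatio_ne_zero {τ : ℂ} (hτ : 0 < τ.im) : etaRatio τ ≠ 0 :=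
  div_ne_zero (eta_ne_zero_of_im_pos (by exact_mod_cast im_natCast_mul_pos (n := 13) (by norm_num) hτ))
    (eta_ne_zero_of_im_pos hτ)

theorem differentiableAt_etaRatio {τ : ℂ} (hτ : 0 < τ.im) : DifferentiableAt ℂ etaRatio τ := by
  refine DifferentiableAt.div ?_ (differentiableAt_eta hτ) (eta_ne_zero_of_im_pos hτ)
  exact DifferentiableAt.comp τ (differentiableAt_eta
    (by exact_mod_cast im_natCast_mul_pos (n := 13) (by norm_num) hτ)) (by fun_prop)

theorem tGamma_eq_etaRatio_div (τ : ℂ) : tGamma τ = etaRatio τ / etaRatio (3 * τ) := by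
  unfold tGamma etaRatio etaScaled
  rw [div_div_div_eq]
  push_cast
  congr 1 <;> ring_nf

theorem etaRatio_add_int (n : ℤ) (τ : ℂ) : etaRatio (τ + n) = (-1) ^ n * etaRatio τ := by
  unfold etaRatio
  have := eta_add_int (13 * n) (13 * τ)
  push_cast at this
  rw [mul_add, this, eta_add_int, mul_div_mul_comm, ← Complex.exp_sub]
  congr 1
  rw [← Complex.exp_pi_mul_I, ← Complex.exp_int_mul]
  congr 1
  ring

/-- The weight zero automorphy relation `η(13γτ)/η(γτ) = ε η(13τ)/η(τ)` for the matrix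
`γ = (a b; 13c d)`. -/
def EtaRatioMult (ε : ℂ) (a b c d : ℤ) : Prop :=
  ∀ τ : ℂ, 0 < τ.im →
    etaRatio (((a : ℂ) * τ + b) / (((13 * c : ℤ) : ℂ) * τ + d)) = ε * etaRatio τ

theorem mobius_comp {a b c d a' b' c' d' : ℤ} (h' : 0 < a' * d' - b' * c')
    {τ : ℂ} (hτ : 0 < τ.im) :
    ((a : ℂ) * (((a' : ℂ) * τ + b') / ((c' : ℂ) * τ + d')) + b) /
      ((c : ℂ) * (((a' : ℂ) * τ + b') / ((c' : ℂ) * τ + d')) + d) =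
    (((a * a' + b * c' : ℤ) : ℂ) * τ + (a * b' + b * d' : ℤ)) /
      (((c * a' + d * c' : ℤ) : ℂ) * τ + (c * b' + d * d' : ℤ)) := by
  have h1 := mobius_denom_ne_zero h' hτ
  have h2 := div_mul_cancel₀ ((a' : ℂ) * τ + b') h1
  rw [← mul_div_mul_right _ _ h1]
  congr 1 <;> push_cast
  · linear_combination (a : ℂ) * h2
  · linear_combination (c : ℂ) * h2

theorem EtaRatioMult.mul {ε ε' : ℂ} {a b c d a' b' c' d' : ℤ} (h : EtaRatioMult ε a b c d)
    (h' : EtaRatioMult ε' a' b' c' d') (hd : a * d - 13 * (b * c) = 1)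
    (hd' : a' * d' - 13 * (b' * c') = 1) :
    EtaRatioMult (ε * ε') (a * a' + 13 * (b * c')) (a * b' + b * d') (c * a' + d * c')
      (13 * (c * b') + d * d') := by
  intro τ hτ
  have h1 : (0 : ℤ) < a * d - b * (13 * c) := by linarith
  have h2 : (0 : ℤ) < a' * d' - b' * (13 * c') := by linarith
  have := h _ (mobius_im_pos h2 hτ)
  rw [mobius_comp h2 hτ, h' τ hτ] at this
  rw [mul_assoc, ← this]
  congr 1
  push_cast
  ring

theorem EtaRatioMult.inv {ε : ℂ} {a b c d : ℤ} (h : EtaRatioMult ε a b c d) (hε : ε * ε = 1)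
    (hd : a * d - 13 * (b * c) = 1) : EtaRatioMult ε d (-b) (-c) a := by
  intro τ hτ
  have h1 : (0 : ℤ) < a * d - b * (13 * c) := by linarith
  have h2 : (0 : ℤ) < d * a - -b * (13 * -c) := by linarith
  have := h _ (mobius_im_pos h2 hτ)
  rw [mobius_comp h2 hτ] at this
  have e1 : a * d + b * (13 * -c) = 1 := by linarith
  have e2 : a * -b + b * a = 0 := by ring
  have e3 : 13 * c * d + d * (13 * -c) = 0 := by ring
  have e4 : 13 * c * -b + d * a = 1 := by linarith
  rw [e1, e2, e3, e4] at this
  simp only [Int.cast_one, one_mul, Int.cast_zero, add_zero, zero_mul, zero_add, div_one] at this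
  rw [this, ← mul_assoc, hε, one_mul]

theorem EtaRatioMult.neg {ε : ℂ} {a b c d : ℤ} (h : EtaRatioMult ε a b c d) :
    EtaRatioMult ε (-a) (-b) (-c) (-d) := by
  intro τ hτ
  rw [← h τ hτ, ← neg_div_neg_eq]
  congr 1
  push_cast
  ring

theorem etaRatioMult_translation (n : ℤ) : EtaRatioMult ((-1) ^ n) 1 n 0 1 := by
  intro τ _
  simpa using etaRatio_add_int n τ

theorem etaRatio_mobius_pow {a b c d : ℤ} (hd : a * d - 13 * (b * c) = 1) {τ : ℂ}
    (hτ : 0 < τ.im) :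
    etaRatio (((a : ℂ) * τ + b) / (((13 * c : ℤ) : ℂ) * τ + d)) ^ 24 = etaRatio τ ^ 24 := by
  have h1 : a * d - b * (13 * c) = 1 := by linarith
  have h2 : a * d - (13 * b) * c = 1 := by linarith
  have h13 : 0 < (13 * τ).im := by exact_mod_cast im_natCast_mul_pos (n := 13) (by norm_num) hτ
  have e1 := eta_mobius_pow h1 hτ
  have e2 := eta_mobius_pow h2 h13
  have hne := mobius_denom_ne_zero (a := a) (b := b) (c := 13 * c) (d := d) (by omega) hτ
  have e3 : (13 : ℂ) * (((a : ℂ) * τ + b) / (((13 * c : ℤ) : ℂ) * τ + d)) =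
      ((a : ℂ) * (13 * τ) + (13 * b : ℤ)) / ((c : ℂ) * (13 * τ) + d) := by
    rw [mul_div_assoc']
    push_cast
    congr 1 <;> ring
  have e4 : (c : ℂ) * (13 * τ) + d = ((13 * c : ℤ) : ℂ) * τ + d := by push_cast; ring
  unfold etaRatio
  rw [e3, div_pow, div_pow, e1, e2, e4]
  exact mul_div_mul_left _ _ (pow_ne_zero _ hne)

/-- The quotient of the two sides is continuous with 24th power 1, hence constant on the connected
half-plane. -/
theorem exists_etaRatioMult {a b c d : ℤ} (hd : a * d - 13 * (b * c) = 1) :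
    ∃ ε, EtaRatioMult ε a b c d := by
  have hpos : 0 < a * d - b * (13 * c) := by linarith
  let f : ℂ → ℂ := fun τ =>
    etaRatio (((a : ℂ) * τ + b) / (((13 * c : ℤ) : ℂ) * τ + d)) / etaRatio τ
  have hf : ∀ τ : ℂ, 0 < τ.im → ContinuousAt f τ := by
    intro τ hτ
    refine ContinuousAt.div ?_ (differentiableAt_etaRatio hτ).continuousAt (etaRatio_ne_zero hτ)
    exact ContinuousAt.comp
      (f := fun τ : ℂ => ((a : ℂ) * τ + b) / (((13 * c : ℤ) : ℂ) * τ + d))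
      (differentiableAt_etaRatio (mobius_im_pos hpos hτ)).continuousAt
      (ContinuousAt.div (by fun_prop) (by fun_prop) (mobius_denom_ne_zero hpos hτ))
  have hw : ∀ τ : ℂ, 0 < τ.im → f τ ^ 24 = 1 := by
    intro τ hτ
    simp only [f]
    rw [div_pow, etaRatio_mobius_pow hd hτ, div_self (pow_ne_zero _ (etaRatio_ne_zero hτ))]
  refine ⟨f Complex.I, fun τ hτ => ?_⟩
  rw [eq_of_pow_eq_const (by norm_num) hf hw (τ := Complex.I) (by simp) hτ]
  exact (div_mul_cancel₀ _ (etaRatio_ne_zero hτ)).symm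

/-- Evaluating the automorphy relation at a fixed point, where `etaRatio` is nonzero, forces the
multiplier to be 1. -/
theorem etaRatioMult_of_fixed_point {a b c d : ℤ} (hd : a * d - 13 * (b * c) = 1) {τ : ℂ}
    (hτ : 0 < τ.im) (hfix : (a : ℂ) * τ + b = τ * (((13 * c : ℤ) : ℂ) * τ + d)) :
    EtaRatioMult 1 a b c d := by
  obtain ⟨ε, hε⟩ := exists_etaRatioMult hd
  have h := hε τ hτ
  have hne := mobius_denom_ne_zero (a := a) (b := b) (c := 13 * c) (d := d) (by linarith) hτ
  rw [hfix, mul_div_cancel_right₀ _ hne] at h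
  have : ε = 1 := by
    have h0 := etaRatio_ne_zero hτ
    exact mul_right_cancel₀ h0 (by rw [one_mul]; exact h.symm)
  rwa [this] at hε

theorem im_neg_inv_pos {τ : ℂ} (hτ : 0 < τ.im) : 0 < (-1 / τ).im := by
  simpa using mobius_im_pos (a := 0) (b := -1) (c := 1) (d := 0) (by norm_num) hτ

theorem eta_neg_inv_pow {τ : ℂ} (hτ : 0 < τ.im) :
    ModularForm.eta (-1 / τ) ^ 24 = τ ^ 12 * ModularForm.eta τ ^ 24 := by
  simpa using eta_mobius_pow (a := 0) (b := -1) (c := 1) (d := 0) (by norm_num) hτ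

theorem im_thirteen_mul_pos {τ : ℂ} (hτ : 0 < τ.im) : 0 < (13 * τ).im := by
  exact_mod_cast im_natCast_mul_pos (n := 13) (by norm_num) hτ

theorem ne_zero_of_im_pos {τ : ℂ} (hτ : 0 < τ.im) : τ ≠ 0 := by
  rintro rfl
  simp at hτ

theorem exists_etaRatio_fricke :
    ∃ κ : ℂ, ∀ τ : ℂ, 0 < τ.im → etaRatio (-1 / (13 * τ)) * etaRatio τ = κ := by
  let f : ℂ → ℂ := fun τ => etaRatio (-1 / (13 * τ)) * etaRatio τ
  have hf : ∀ τ : ℂ, 0 < τ.im → ContinuousAt f τ := by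
    intro τ hτ
    refine ContinuousAt.mul ?_ (differentiableAt_etaRatio hτ).continuousAt
    have h13 := im_thirteen_mul_pos hτ
    exact ContinuousAt.comp (f := fun τ : ℂ => -1 / (13 * τ))
      (differentiableAt_etaRatio (im_neg_inv_pos h13)).continuousAt
      (ContinuousAt.div (by fun_prop) (by fun_prop) (ne_zero_of_im_pos h13))
  have hw : ∀ τ : ℂ, 0 < τ.im → f τ ^ 24 = (13 ^ 12)⁻¹ := by
    intro τ hτ
    have h13 := im_thirteen_mul_pos hτ
    have h0 := ne_zero_of_im_pos hτ
    have e : (13 : ℂ) * (-1 / (13 * τ)) = -1 / τ := by field_simp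
    have n1 := eta_ne_zero_of_im_pos hτ
    have n2 := eta_ne_zero_of_im_pos h13
    simp only [f, etaRatio]
    rw [mul_pow, div_pow, div_pow, e, eta_neg_inv_pow hτ, eta_neg_inv_pow h13]
    generalize ModularForm.eta τ = x at *
    generalize ModularForm.eta (13 * τ) = y at *
    rw [mul_pow]
    field_simp
  exact ⟨f Complex.I, fun τ hτ => eq_of_pow_eq_const (by norm_num) hf hw hτ (by simp)⟩

/-- The map τ ↦ -1/(13τ) conjugates this matrix to translation by -1, which changes the sign of
`etaRatio`; the Fricke relation carries that sign over. -/
theorem etaRatioMult_lower_unipotent : EtaRatioMult (-1) 1 0 1 1 := by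
  obtain ⟨κ, hκ⟩ := exists_etaRatio_fricke
  intro τ hτ
  have h13 := im_thirteen_mul_pos hτ
  have hu := im_neg_inv_pos h13
  have hne := ne_zero_of_im_pos hτ
  set u : ℂ := -1 / (13 * τ) with hu_def
  have hv : 0 < (u + (-1 : ℤ)).im := by simpa using hu
  have hden : (13 : ℂ) * τ + 1 ≠ 0 := by
    simpa using mobius_denom_ne_zero (a := 1) (b := 0) (c := 13) (d := 1) (by norm_num) hτ
  have e : ((1 : ℤ) * τ + (0 : ℤ)) / (((13 * 1 : ℤ) : ℂ) * τ + (1 : ℤ)) =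
      -1 / (13 * (u + (-1 : ℤ))) := by
    have hvne := ne_zero_of_im_pos hv
    have : 13 * τ * u = -1 := by rw [hu_def]; field_simp
    push_cast at hvne ⊢
    rw [div_eq_div_iff (by simpa using hden) (by simpa using hvne)]
    linear_combination this
  rw [e]
  have h1 := hκ _ hv
  have h2 := hκ _ hτ
  rw [etaRatio_add_int] at h1
  have h3 := etaRatio_ne_zero hu
  have h4 : (etaRatio (-1 / (13 * (u + (-1 : ℤ)))) + etaRatio τ) * etaRatio u = 0 := by
    rw [← hu_def] at h2
    simp only [zpow_neg, zpow_one] at h1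
    norm_num at h1
    push_cast
    linear_combination h2 - h1
  have h5 := (mul_eq_zero.1 h4).resolve_right h3
  linear_combination h5

/-! ### The sign character, and generation of Γ₀(13). -/

/-- The sign of the permutation of the three nonzero vectors of `𝔽₂²` induced by a matrix. -/
def signModTwo (a b c d : ZMod 2) : ℤ :=
  if a + d = 1 ∨ (b = 0 ∧ c = 0) then 1 else -1

theorem signModTwo_mul : ∀ a b c d a' b' c' d' : ZMod 2, a * d - b * c = 1 →
    a' * d' - b' * c' = 1 →
    signModTwo (a * a' + b * c') (a * b' + b * d') (c * a' + d * c') (c * b' + d * d') =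
      signModTwo a b c d * signModTwo a' b' c' d' := by
  decide

/-- The Legendre symbol modulo `13`, on nonzero residues. -/
def signModThirteen (d : ZMod 13) : ℤ :=
  if d ^ 6 = 1 then 1 else -1

theorem signModThirteen_mul : ∀ d d' : ZMod 13, d ≠ 0 → d' ≠ 0 →
    signModThirteen (d * d') = signModThirteen d * signModThirteen d' := by
  decide

theorem signModThirteen_neg (d : ZMod 13) : signModThirteen (-d) = signModThirteen d := by
  unfold signModThirteen
  rw [Even.neg_pow (by decide)]

/-- The multiplier of `η(13τ)/η(τ)` at `(a b; 13c d)`. -/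
def etaRatioSign (a b c d : ℤ) : ℤ :=
  signModThirteen d * signModTwo a b c d

theorem intCast_zmod_thirteen_ne_zero {a b c d : ℤ} (hd : a * d - 13 * (b * c) = 1) :
    (d : ZMod 13) ≠ 0 := by
  have h0 : (13 : ZMod 13) = 0 := by decide
  intro h
  have := congrArg (Int.cast : ℤ → ZMod 13) hd
  push_cast at this
  rw [h, h0] at this
  revert this
  simp only [mul_zero, zero_mul, sub_zero]
  decide

theorem etaRatioSign_mul {a b c d a' b' c' d' : ℤ} (hd : a * d - 13 * (b * c) = 1)
    (hd' : a' * d' - 13 * (b' * c') = 1) :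
    etaRatioSign (a * a' + 13 * (b * c')) (a * b' + b * d') (c * a' + d * c')
      (13 * (c * b') + d * d') = etaRatioSign a b c d * etaRatioSign a' b' c' d' := by
  have h13 : (13 : ZMod 2) = 1 := by decide
  have h0 : (13 : ZMod 13) = 0 := by decide
  have k1 : (a * d - b * c : ZMod 2) = 1 := by
    have := congrArg (Int.cast : ℤ → ZMod 2) hd
    push_cast at this
    rwa [h13, one_mul] at this
  have k2 : (a' * d' - b' * c' : ZMod 2) = 1 := by
    have := congrArg (Int.cast : ℤ → ZMod 2) hd'
    push_cast at this
    rwa [h13, one_mul] at this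
  unfold etaRatioSign
  push_cast
  rw [h13, h0, one_mul, one_mul, zero_mul, zero_add, signModTwo_mul _ _ _ _ _ _ _ _ k1 k2, signModThirteen_mul _ _ (intCast_zmod_thirteen_ne_zero hd)
    (intCast_zmod_thirteen_ne_zero hd')]
  ring

theorem etaRatioSign_sq (a b c d : ℤ) :
    etaRatioSign a b c d * etaRatioSign a b c d = 1 := by
  have h1 : signModTwo a b c d * signModTwo a b c d = 1 := by
    unfold signModTwo
    split_ifs <;> norm_num
  have h2 : signModThirteen d * signModThirteen d = 1 := by
    unfold signModThirteen
    split_ifs <;> norm_num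
  unfold etaRatioSign
  linear_combination (signModTwo a b c d * signModTwo a b c d) * h2 + h1

/-- The relation `EtaRatioMult` with the multiplier given by `etaRatioSign`. -/
def HasEtaRatioSign (a b c d : ℤ) : Prop :=
  a * d - 13 * (b * c) = 1 ∧ EtaRatioMult (etaRatioSign a b c d : ℤ) a b c d

theorem HasEtaRatioSign.mul {a b c d a' b' c' d' : ℤ} (h : HasEtaRatioSign a b c d)
    (h' : HasEtaRatioSign a' b' c' d') :
    HasEtaRatioSign (a * a' + 13 * (b * c')) (a * b' + b * d') (c * a' + d * c')
      (13 * (c * b') + d * d') := by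
  refine ⟨by linear_combination (a' * d' - 13 * (b' * c')) * h.1 + h'.1, ?_⟩
  rw [etaRatioSign_mul h.1 h'.1]
  push_cast
  exact h.2.mul h'.2 h.1 h'.1

theorem HasEtaRatioSign.inv {a b c d : ℤ} (h : HasEtaRatioSign a b c d) :
    HasEtaRatioSign d (-b) (-c) a := by
  have hdet : d * a - 13 * (-b * -c) = 1 := by linear_combination h.1
  have hsq := etaRatioSign_sq a b c d
  have hmul := etaRatioSign_mul h.1 hdet
  have hone : etaRatioSign 1 0 0 1 = 1 := by decide
  have e1 : a * d + 13 * (b * -c) = 1 := by linear_combination h.1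
  have e2 : a * -b + b * a = 0 := by ring
  have e3 : c * d + d * -c = 0 := by ring
  have e4 : 13 * (c * -b) + d * a = 1 := by linear_combination h.1
  rw [e1, e2, e3, e4, hone] at hmul
  have heq : etaRatioSign d (-b) (-c) a = etaRatioSign a b c d := by
    linear_combination (-etaRatioSign a b c d) * hmul - etaRatioSign d (-b) (-c) a * hsq
  refine ⟨hdet, ?_⟩
  rw [heq]
  exact h.2.inv (by exact_mod_cast hsq) h.1

theorem HasEtaRatioSign.neg {a b c d : ℤ} (h : HasEtaRatioSign a b c d) :
    HasEtaRatioSign (-a) (-b) (-c) (-d) := by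
  refine ⟨by linear_combination h.1, ?_⟩
  have : etaRatioSign (-a) (-b) (-c) (-d) = etaRatioSign a b c d := by
    unfold etaRatioSign
    push_cast
    rw [signModThirteen_neg]
    simp only [ZMod.neg_eq_self_mod_two]
  rw [this]
  exact h.2.neg

theorem hasEtaRatioSign_translation (n : ℤ) : HasEtaRatioSign 1 n 0 1 := by
  refine ⟨by ring, ?_⟩
  convert etaRatioMult_translation n
  unfold etaRatioSign signModThirteen signModTwo
  have h2 : ¬ ((1 : ZMod 2) + 1 = 1) := by decide
  rcases Int.even_or_odd n with hn | hn
  · have : (n : ZMod 2) = 0 := (ZMod.intCast_zmod_eq_zero_iff_dvd n 2).2 hn.two_dvd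
    simp [hn.neg_one_zpow, this]
  · have : (n : ZMod 2) ≠ 0 := fun h =>
      (Int.not_even_iff_odd.2 hn) (even_iff_two_dvd.2 ((ZMod.intCast_zmod_eq_zero_iff_dvd n 2).1 h))
    simp [hn.neg_one_zpow, this, h2]

theorem hasEtaRatioSign_lower_unipotent : HasEtaRatioSign 1 0 1 1 := by
  refine ⟨by norm_num, ?_⟩
  have : etaRatioSign 1 0 1 1 = -1 := by decide
  rw [this]
  exact_mod_cast etaRatioMult_lower_unipotent

theorem hasEtaRatioSign_of_order_four {a b : ℤ} (hdet : a * (-a) - 13 * (b * 1) = 1)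
    (hs : etaRatioSign a b 1 (-a) = 1) : HasEtaRatioSign a b 1 (-a) := by
  refine ⟨hdet, ?_⟩
  rw [hs]
  have hq : (a : ℂ) * (-a) - 13 * b = 1 := by exact_mod_cast (by linarith : a * (-a) - 13 * b = 1)
  simpa using etaRatioMult_of_fixed_point hdet (τ := (a + Complex.I) / 13)
    (by simp) (by push_cast; linear_combination -(1/13 : ℂ) * hq - (1 / 13 : ℂ) * Complex.I_sq)

/-- The fixed point equation 13τ² + (d - a)τ - b = 0 has discriminant (a + d)² - 4 = -3. -/
theorem hasEtaRatioSign_of_order_three {a b d : ℤ} (hdet : a * d - 13 * (b * 1) = 1)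
    (htr : (a + d) ^ 2 = 1) (hs : etaRatioSign a b 1 d = 1) : HasEtaRatioSign a b 1 d := by
  refine ⟨hdet, ?_⟩
  rw [hs]
  have hq : (a : ℂ) * d - 13 * b = 1 := by exact_mod_cast (by linarith : a * d - 13 * b = 1)
  have ht : ((a : ℂ) + d) ^ 2 = 1 := by exact_mod_cast htr
  have h3 : ((√3 : ℝ) : ℂ) ^ 2 = 3 := by
    norm_cast
    exact Real.sq_sqrt (by norm_num)
  simpa using etaRatioMult_of_fixed_point hdet
    (τ := ((a - d : ℤ) + (√3 : ℝ) * Complex.I) / 26) (by simp)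
    (by
      push_cast
      linear_combination -(1/13 : ℂ) * hq + (1 / 52 : ℂ) * ht - (3 / 52 : ℂ) * Complex.I_sq
        - (1 / 52 : ℂ) * Complex.I ^ 2 * h3)

/-- Representatives `(α β; 13 δ)` for all nonzero residues of `α` modulo `13`. -/
theorem exists_hasEtaRatioSign_residue (r : ℤ) (h0 : 0 < r) (h13 : r < 13) :
    ∃ α β δ k : ℤ, r = 13 * k + α ∧ HasEtaRatioSign α β 1 δ := by
  have e5 : HasEtaRatioSign 5 (-2) 1 (-5) :=
    hasEtaRatioSign_of_order_four (by norm_num) (by decide)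
  have f5 : HasEtaRatioSign (-5) (-2) 1 5 := by
    simpa using hasEtaRatioSign_of_order_four (a := -5) (b := -2) (by norm_num) (by decide)
  have e4 : HasEtaRatioSign 4 (-1) 1 (-3) :=
    hasEtaRatioSign_of_order_three (by norm_num) (by norm_num) (by decide)
  have f4 : HasEtaRatioSign (-4) (-1) 1 3 :=
    hasEtaRatioSign_of_order_three (by norm_num) (by norm_num) (by decide)
  have e3 : HasEtaRatioSign 3 (-1) 1 (-4) :=
    hasEtaRatioSign_of_order_three (by norm_num) (by norm_num) (by decide)
  have f3 : HasEtaRatioSign (-3) (-1) 1 4 :=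
    hasEtaRatioSign_of_order_three (by norm_num) (by norm_num) (by decide)
  have e1 := hasEtaRatioSign_lower_unipotent
  have f1 : HasEtaRatioSign (-1) 0 1 (-1) := by simpa using e1.inv.neg
  -- The residues ±6 and ±2 are reached by products of elliptic elements and by inverses up to sign.
  have e6 : HasEtaRatioSign 6 (-1) 1 (-2) := by simpa using (e5.mul e4).neg
  have f6 : HasEtaRatioSign (-6) (-1) 1 2 := by simpa using f5.mul f4
  have e2 : HasEtaRatioSign 2 (-1) 1 (-6) := by simpa using e6.inv.neg
  have f2 : HasEtaRatioSign (-2) (-1) 1 6 := by simpa using f6.inv.neg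
  interval_cases r
  · exact ⟨_, _, _, 0, by norm_num, e1⟩
  · exact ⟨_, _, _, 0, by norm_num, e2⟩
  · exact ⟨_, _, _, 0, by norm_num, e3⟩
  · exact ⟨_, _, _, 0, by norm_num, e4⟩
  · exact ⟨_, _, _, 0, by norm_num, e5⟩
  · exact ⟨_, _, _, 0, by norm_num, e6⟩
  · exact ⟨_, _, _, 1, by norm_num, f6⟩
  · exact ⟨_, _, _, 1, by norm_num, f5⟩
  · exact ⟨_, _, _, 1, by norm_num, f4⟩
  · exact ⟨_, _, _, 1, by norm_num, f3⟩
  · exact ⟨_, _, _, 1, by norm_num, f2⟩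
  · exact ⟨_, _, _, 1, by norm_num, f1⟩

theorem exists_hasEtaRatioSign (A : ℤ) (hA : ¬ (13 : ℤ) ∣ A) :
    ∃ β δ : ℤ, HasEtaRatioSign A β 1 δ := by
  obtain ⟨α, β, δ, k, hr, h⟩ := exists_hasEtaRatioSign_residue (A % 13)
    (by omega) (by omega)
  have hA' : 1 * α + 13 * ((A / 13 + k) * 1) = A := by omega
  have := (hasEtaRatioSign_translation (A / 13 + k)).mul h
  rw [hA'] at this
  exact ⟨_, _, by simpa using this⟩

/-- Euclidean descent on |c|: right multiplication by (A β; 13 δ) replaces c by cA + d. Such a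
matrix exists only when 13 does not divide A, which restricts the choice of quotient. -/
theorem hasEtaRatioSign_of_natAbs (n : ℕ) : ∀ a b c d : ℤ, c.natAbs = n →
    a * d - 13 * (b * c) = 1 → HasEtaRatioSign a b c d := by
  induction n using Nat.strong_induction_on with
  | _ n ih =>
    intro a b c d hc hdet
    by_cases hc0 : c = 0
    · subst hc0
      have had : a * d = 1 := by linarith
      rcases Int.eq_one_or_neg_one_of_mul_eq_one' had with ⟨rfl, rfl⟩ | ⟨rfl, rfl⟩
      · exact hasEtaRatioSign_translation b
      · simpa using (hasEtaRatioSign_translation (-b)).neg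
    · obtain ⟨A, hA, hlt⟩ : ∃ A : ℤ, ¬ (13 : ℤ) ∣ A ∧ (c * A + d).natAbs < c.natAbs := by
        have hrem : (-d) % c = -d - c * ((-d) / c) := by
          have := Int.emod_add_mul_ediv (-d) c
          linarith
        have hnn := Int.emod_nonneg (-d) hc0
        have hlt := Int.emod_lt_abs (-d) hc0
        by_cases h13 : (13 : ℤ) ∣ (-d) / c
        -- If 13 divides the quotient, a neighbouring integer is used. It leaves |c| minus the
        -- remainder, which is smaller than |c| because a zero remainder would give 13 ∣ d, against
        -- the determinant.
        · have hne : (-d) % c ≠ 0 := by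
            intro h0
            obtain ⟨m, hm⟩ := h13
            rw [h0, hm] at hrem
            have : (13 : ℤ) ∣ 1 := ⟨-(a * c * m) - b * c, by
              linear_combination -hdet + a * hrem⟩
            norm_num at this
          rcases lt_or_gt_of_ne hc0 with hneg | hpos
          · refine ⟨(-d) / c - 1, by omega, ?_⟩
            rw [abs_of_neg hneg] at hlt
            rw [show c * (-d / c - 1) + d = -((-d) % c) - c by rw [hrem]; ring]
            omega
          · refine ⟨(-d) / c + 1, by omega, ?_⟩
            rw [abs_of_pos hpos] at hlt
            rw [show c * (-d / c + 1) + d = -((-d) % c) + c by rw [hrem]; ring]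
            omega
        · refine ⟨(-d) / c, h13, ?_⟩
          rw [show c * (-d / c) + d = -((-d) % c) by rw [hrem]; ring]
          rw [Int.abs_eq_natAbs] at hlt
          omega
      obtain ⟨β, δ, hg⟩ := exists_hasEtaRatioSign A hA
      have hgdet := hg.1
      have h1 := ih _ (hc ▸ hlt) (a * A + 13 * (b * 1)) (a * β + b * δ) (c * A + d)
        (13 * (c * β) + d * δ) rfl
        (by linear_combination (A * δ - 13 * β) * hdet + hgdet)
      have h2 := h1.mul hg.inv
      convert h2 using 1
      · linear_combination -a * hgdet
      · linear_combination -b * hgdet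
      · linear_combination -c * hgdet
      · linear_combination -d * hgdet

/-- The transformation law of `η(13τ)/η(τ)` under `Γ₀(13)`. -/
theorem etaRatio_mobius {a b c d : ℤ} (hd : a * d - 13 * (b * c) = 1) {τ : ℂ} (hτ : 0 < τ.im) :
    etaRatio (((a : ℂ) * τ + b) / (((13 * c : ℤ) : ℂ) * τ + d)) =
      (etaRatioSign a b c d : ℤ) * etaRatio τ :=
  (hasEtaRatioSign_of_natAbs _ a b c d rfl hd).2 τ hτ

/-! ### Atkin-Lehner symmetries of t at level 39. -/

theorem im_ofNat_mul_pos (n : ℕ) [n.AtLeastTwo] {τ : ℂ} (hτ : 0 < τ.im) :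
    0 < ((OfNat.ofNat n : ℂ) * τ).im := by
  have h0 : 0 < n := by have := Nat.AtLeastTwo.prop (n := n); omega
  have := im_natCast_mul_pos (n := OfNat.ofNat n) h0 hτ
  rwa [Nat.cast_ofNat] at this

theorem tGamma_mobius {a b c d : ℤ} (hd : a * d - 39 * (b * c) = 1) {τ : ℂ} (hτ : 0 < τ.im) :
    tGamma (((a : ℂ) * τ + b) / (((39 * c : ℤ) : ℂ) * τ + d)) = tGamma τ := by
  have h3 := im_ofNat_mul_pos 3 hτ
  have r1 := etaRatio_mobius (a := a) (b := b) (c := 3 * c) (d := d) (by linarith) hτ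
  have r2 := etaRatio_mobius (a := a) (b := 3 * b) (c := c) (d := d) (by linarith) h3
  have e1 : 13 * (3 * c) = 39 * c := by ring
  have e2 : (3 : ℂ) * (((a : ℂ) * τ + b) / (((39 * c : ℤ) : ℂ) * τ + d)) =
      ((a : ℂ) * (3 * τ) + (3 * b : ℤ)) / (((13 * c : ℤ) : ℂ) * (3 * τ) + d) := by
    rw [mul_div_assoc']
    push_cast
    congr 1 <;> ring
  have es : etaRatioSign a (3 * b) c d = etaRatioSign a b (3 * c) d := by
    unfold etaRatioSign
    push_cast
    rw [show (3 : ZMod 2) = 1 by decide, one_mul, one_mul]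
  have hsq : ((etaRatioSign a b (3 * c) d : ℤ) : ℂ) ≠ 0 := by
    have := etaRatioSign_sq a b (3 * c) d
    exact_mod_cast left_ne_zero_of_mul (by rw [this]; exact one_ne_zero)
  rw [e1] at r1
  rw [tGamma_eq_etaRatio_div, tGamma_eq_etaRatio_div, r1, e2, r2, es, mul_div_mul_left _ _ hsq]

/-- The map interchanges the roles of τ and 3τ, which inverts t. The two signs agree because 3 is
odd and a square modulo 13. -/
theorem tGamma_mobius_three {a b c d : ℤ} (hd : 3 * (a * d) - 13 * (b * c) = 1) {τ : ℂ}
    (hτ : 0 < τ.im) :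
    tGamma ((((3 * a : ℤ) : ℂ) * τ + b) / (((39 * c : ℤ) : ℂ) * τ + (3 * d : ℤ))) =
      (tGamma τ)⁻¹ := by
  have h3 := im_ofNat_mul_pos 3 hτ
  have r1 := etaRatio_mobius (a := a) (b := b) (c := c) (d := 3 * d) (by linarith) h3
  have r2 := etaRatio_mobius (a := 3 * a) (b := b) (c := c) (d := d) (by linarith) hτ
  have hne := mobius_denom_ne_zero (a := 3 * a) (b := b) (c := 13 * c) (d := d) (by linarith) hτ
  have e1 : (((3 * a : ℤ) : ℂ) * τ + b) / (((39 * c : ℤ) : ℂ) * τ + (3 * d : ℤ)) =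
      ((a : ℂ) * (3 * τ) + b) / (((13 * c : ℤ) : ℂ) * (3 * τ) + (3 * d : ℤ)) := by
    push_cast
    congr 1 <;> ring
  have e2 : (3 : ℂ) * ((((3 * a : ℤ) : ℂ) * τ + b) / (((39 * c : ℤ) : ℂ) * τ + (3 * d : ℤ))) =
      (((3 * a : ℤ) : ℂ) * τ + b) / (((13 * c : ℤ) : ℂ) * τ + d) := by
    rw [show ((39 * c : ℤ) : ℂ) * τ + (3 * d : ℤ) = 3 * (((13 * c : ℤ) : ℂ) * τ + d) by
      push_cast; ring]
    field_simp
  have hdne := intCast_zmod_thirteen_ne_zero (a := 3 * a) (b := b) (c := c) (d := d) (by linarith)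
  have es : etaRatioSign (3 * a) b c d = etaRatioSign a b c (3 * d) := by
    unfold etaRatioSign
    push_cast
    rw [show (3 : ZMod 2) = 1 by decide, one_mul, one_mul,
      signModThirteen_mul _ _ (by decide) hdne, show signModThirteen 3 = 1 by decide, one_mul]
  have hsq : ((etaRatioSign a b c (3 * d) : ℤ) : ℂ) ≠ 0 := by
    have := etaRatioSign_sq a b c (3 * d)
    exact_mod_cast left_ne_zero_of_mul (by rw [this]; exact one_ne_zero)
  rw [tGamma_eq_etaRatio_div, tGamma_eq_etaRatio_div, e2, r2, e1, r1, es,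
    mul_div_mul_left _ _ hsq, inv_div]

theorem tGamma_ne_zero_of_im_pos {τ : ℂ} (hτ : 0 < τ.im) : tGamma τ ≠ 0 := (tGamma_ne_zero hτ).2

theorem differentiableAt_tGamma {τ : ℂ} (hτ : 0 < τ.im) : DifferentiableAt ℂ tGamma τ := by
  have : tGamma = fun τ => etaRatio τ / etaRatio (3 * τ) := funext tGamma_eq_etaRatio_div
  rw [this]
  have h3 := im_ofNat_mul_pos 3 hτ
  exact (differentiableAt_etaRatio hτ).div
    (DifferentiableAt.comp τ (differentiableAt_etaRatio h3) (by fun_prop)) (etaRatio_ne_zero h3)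

theorem tGamma_fricke {τ : ℂ} (hτ : 0 < τ.im) : tGamma (-1 / (39 * τ)) = tGamma τ := by
  let f : ℂ → ℂ := fun τ => tGamma (-1 / (39 * τ)) / tGamma τ
  have h39 {τ : ℂ} (hτ : 0 < τ.im) := im_ofNat_mul_pos 39 hτ
  have hf : ∀ τ : ℂ, 0 < τ.im → ContinuousAt f τ := by
    intro τ hτ
    refine ContinuousAt.div ?_ (differentiableAt_tGamma hτ).continuousAt (tGamma_ne_zero_of_im_pos hτ)
    exact ContinuousAt.comp (f := fun τ : ℂ => -1 / (39 * τ))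
      (differentiableAt_tGamma (im_neg_inv_pos (h39 hτ))).continuousAt
      (ContinuousAt.div (by fun_prop) (by fun_prop) (ne_zero_of_im_pos (h39 hτ)))
  have hw : ∀ τ : ℂ, 0 < τ.im → f τ ^ 24 = 1 := by
    intro τ hτ
    have h0 := ne_zero_of_im_pos hτ
    have e1 : (3 : ℂ) * (-1 / (39 * τ)) = -1 / (13 * τ) := by field_simp; norm_num
    have e2 : (13 : ℂ) * (-1 / (39 * τ)) = -1 / (3 * τ) := by field_simp; norm_num
    have e3 : (39 : ℂ) * (-1 / (39 * τ)) = -1 / τ := by field_simp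
    have i3 := im_ofNat_mul_pos 3 hτ
    have i13 := im_ofNat_mul_pos 13 hτ
    have n1 := eta_ne_zero_of_im_pos hτ
    have n3 := eta_ne_zero_of_im_pos i3
    have n13 := eta_ne_zero_of_im_pos i13
    have n39 := eta_ne_zero_of_im_pos (h39 hτ)
    simp only [f, tGamma, etaScaled]
    push_cast
    rw [e1, e2, e3, one_mul, one_mul]
    simp only [div_pow, mul_pow]
    rw [eta_neg_inv_pow hτ, eta_neg_inv_pow i3, eta_neg_inv_pow i13, eta_neg_inv_pow (h39 hτ)]
    generalize ModularForm.eta τ = x at *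
    generalize ModularForm.eta (3 * τ) = y at *
    generalize ModularForm.eta (13 * τ) = z at *
    generalize ModularForm.eta (39 * τ) = w at *
    simp only [mul_pow]
    field_simp
    norm_num
  have hs : ((√39 : ℝ) : ℂ) ^ 2 = 39 := by
    norm_cast
    exact Real.sq_sqrt (by norm_num)
  have hs0 : ((√39 : ℝ) : ℂ) ≠ 0 := by
    intro h
    rw [h] at hs
    norm_num at hs
  have hi : 0 < (Complex.I * (√39 : ℝ)).im := by simp
  -- The constant is found at the fixed point i/√39 of the Fricke involution.
  have hfix : -1 / (39 * (Complex.I * ((√39 : ℝ) : ℂ) / 39)) =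
      Complex.I * ((√39 : ℝ) : ℂ) / 39 := by
    field_simp
    linear_combination (-1 : ℂ) * Complex.I ^ 2 * hs - 39 * Complex.I_sq
  have hpos : 0 < (Complex.I * ((√39 : ℝ) : ℂ) / 39).im := by simp
  have h1 : f τ = 1 := by
    rw [eq_of_pow_eq_const (by norm_num) hf hw hτ hpos]
    simp only [f]
    rw [hfix, div_self (tGamma_ne_zero_of_im_pos hpos)]
  exact (div_eq_one_iff_eq (tGamma_ne_zero_of_im_pos hτ)).1 h1

/-- `z` equals `w`, or its inverse if `p` holds. -/
noncomputable def invIf (p : Bool) (z : ℂ) : ℂ := if p then z⁻¹ else z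

/-- The Atkin-Lehner involutions of level `39` fix or invert the eta quotient. -/
theorem tGamma_atkinLehner {f g : ℕ} {p : Bool}
    (hfg : (f, g, p) ∈ [(1, 39, false), (3, 13, true), (13, 3, true), (39, 1, false)])
    {a b c d : ℤ} (hd : f * (a * d) - g * (b * c) = 1) {τ : ℂ} (hτ : 0 < τ.im) :
    tGamma (((f : ℂ) * a * τ + b) / (39 * c * τ + f * d)) = invIf p (tGamma τ) := by
  have h39 := im_ofNat_mul_pos 39 hτ
  have hu := im_neg_inv_pos h39
  have h0 := ne_zero_of_im_pos hτ
  have hu0 := ne_zero_of_im_pos hu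
  have hτu : τ = -1 / (39 * (-1 / (39 * τ))) := by field_simp
  simp only [List.mem_cons, Prod.mk.injEq, List.mem_nil_iff, or_false] at hfg
  rcases hfg with ⟨rfl, rfl, rfl⟩ | ⟨rfl, rfl, rfl⟩ | ⟨rfl, rfl, rfl⟩ | ⟨rfl, rfl, rfl⟩
  · have := tGamma_mobius (a := a) (b := b) (c := c) (d := d) (by push_cast at hd; linarith) hτ
    simpa [invIf] using this
  · have := tGamma_mobius_three (a := a) (b := b) (c := c) (d := d)
      (by push_cast at hd; linarith) hτ
    simpa [invIf] using this
  · rw [← tGamma_fricke hτ]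
    have := tGamma_mobius_three (a := b) (b := -a) (c := d) (d := -c)
      (by push_cast at hd; linarith) hu
    simp only [invIf, if_true]
    rw [← this]
    congr 1
    generalize -1 / (39 * τ) = u at *
    subst hτu
    rw [← mul_div_mul_right _ _ (show (3 * u : ℂ) ≠ 0 by simpa using hu0)]
    congr 1 <;> push_cast <;> field_simp <;> ring
  · rw [← tGamma_fricke hτ]
    have := tGamma_mobius (a := b) (b := -a) (c := d) (d := -c)
      (by push_cast at hd; linarith) hu
    simp only [invIf]
    rw [if_neg (by simp), ← this]
    congr 1
    generalize -1 / (39 * τ) = u at *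
    subst hτu
    rw [← mul_div_mul_right _ _ hu0]
    congr 1 <;> push_cast <;> field_simp <;> ring

/-! ### The cubic relation and its symmetries at level 78. -/

/-- The modular polynomial of level two for `t`. -/
def modularPoly (t s : ℂ) : ℂ :=
  s ^ 3 + t ^ 3 - s ^ 2 * t ^ 2 + 2 * s ^ 2 * t + 2 * s * t ^ 2 - s * t

/-- The normalization of the square of the modular polynomial that is invariant under swapping
the two variables and under inverting both. -/
noncomputable def modularPolyNorm (t s : ℂ) : ℂ := modularPoly t s ^ 2 / (t * s) ^ 3

theorem modularPolyNorm_swap (t s : ℂ) : modularPolyNorm s t = modularPolyNorm t s := by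
  unfold modularPolyNorm modularPoly
  congr 1 <;> ring

/-- Inverting both variables divides `modularPoly` by (ts)³, so its square over (ts)³ is unchanged.
-/
theorem modularPolyNorm_inv {t s : ℂ} (ht : t ≠ 0) (hs : s ≠ 0) :
    modularPolyNorm t⁻¹ s⁻¹ = modularPolyNorm t s := by
  unfold modularPolyNorm modularPoly
  field_simp
  ring

theorem modularPolyNorm_invIf (p : Bool) {t s : ℂ} (ht : t ≠ 0) (hs : s ≠ 0) :
    modularPolyNorm (invIf p t) (invIf p s) = modularPolyNorm t s := by
  cases p
  · simp [invIf]
  · simpa [invIf] using modularPolyNorm_inv ht hs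

/-- The modular polynomial at `t(τ), t(2τ)`, normalized. -/
noncomputable def modularDefect (τ : ℂ) : ℂ := modularPolyNorm (tGamma τ) (tGamma (2 * τ))

theorem modularDefect_atkinLehner_odd {f g : ℕ} {p : Bool}
    (hfg : (f, g, p) ∈ [(1, 39, false), (3, 13, true), (13, 3, true), (39, 1, false)])
    {a b c d : ℤ} (hd : f * (a * d) - (2 * g) * (b * c) = 1) {τ : ℂ} (hτ : 0 < τ.im) :
    modularDefect (((f : ℂ) * a * τ + b) / (78 * c * τ + f * d)) = modularDefect τ := by
  have h2 := im_ofNat_mul_pos 2 hτ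
  have t1 := tGamma_atkinLehner hfg (a := a) (b := b) (c := 2 * c) (d := d) (by linarith) hτ
  have t2 := tGamma_atkinLehner hfg (a := a) (b := 2 * b) (c := c) (d := d) (by linarith) h2
  unfold modularDefect
  rw [← modularPolyNorm_invIf p (tGamma_ne_zero_of_im_pos hτ) (tGamma_ne_zero_of_im_pos h2), ← t1, ← t2]
  congr 2
  · push_cast
    congr 1; ring
  · rw [mul_div_assoc']
    push_cast
    congr 1 <;> ring

/-- For even index the map exchanges the roles of τ and 2τ, which is absorbed by the symmetry of the
cubic. -/
theorem modularDefect_atkinLehner_even {f g : ℕ} {p : Bool}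
    (hfg : (f, g, p) ∈ [(1, 39, false), (3, 13, true), (13, 3, true), (39, 1, false)])
    {a b c d : ℤ} (hd : 2 * f * (a * d) - g * (b * c) = 1) {τ : ℂ} (hτ : 0 < τ.im) :
    modularDefect ((2 * (f : ℂ) * a * τ + b) / (78 * c * τ + 2 * f * d)) = modularDefect τ := by
  have h2 := im_ofNat_mul_pos 2 hτ
  have t1 := tGamma_atkinLehner hfg (a := a) (b := b) (c := c) (d := 2 * d) (by linarith) h2
  have t2 := tGamma_atkinLehner hfg (a := 2 * a) (b := b) (c := c) (d := d) (by linarith) hτ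
  unfold modularDefect
  rw [← modularPolyNorm_swap (tGamma τ), ← modularPolyNorm_invIf p (tGamma_ne_zero_of_im_pos h2)
    (tGamma_ne_zero_of_im_pos hτ), ← t1, ← t2]
  congr 2
  · push_cast
    congr 1 <;> ring
  · have : (78 * c * τ + 2 * f * d : ℂ) = 2 * (39 * c * τ + f * d) := by ring
    rw [this, mul_div_assoc', mul_div_mul_left _ _ two_ne_zero]
    push_cast
    congr 1; ring

theorem modularDefect_atkinLehner {e g : ℕ} (heg : e * g = 78)
    {a b c d : ℤ} (hd : e * (a * d) - g * (b * c) = 1) {τ : ℂ} (hτ : 0 < τ.im) :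
    modularDefect (((e * a : ℤ) * τ + b) / ((78 * c : ℤ) * τ + (e * d : ℤ))) =
      modularDefect τ := by
  have he : e ∈ Nat.divisors 78 := Nat.mem_divisors.2 ⟨Dvd.intro _ heg, by norm_num⟩
  rw [show Nat.divisors 78 = {1, 2, 3, 6, 13, 26, 39, 78} by decide] at he
  simp only [Finset.mem_insert, Finset.mem_singleton] at he
  rcases he with rfl | rfl | rfl | rfl | rfl | rfl | rfl | rfl
  · obtain rfl : g = 78 := by omega
    convert modularDefect_atkinLehner_odd (f := 1) (g := 39) (p := false) (by simp) hd hτ using 2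
    push_cast; ring
  · obtain rfl : g = 39 := by omega
    convert modularDefect_atkinLehner_even (f := 1) (g := 39) (p := false) (by simp) hd hτ using 2
    push_cast; ring
  · obtain rfl : g = 26 := by omega
    convert modularDefect_atkinLehner_odd (f := 3) (g := 13) (p := true) (by simp) hd hτ using 2
    push_cast; ring
  · obtain rfl : g = 13 := by omega
    convert modularDefect_atkinLehner_even (f := 3) (g := 13) (p := true) (by simp) hd hτ using 2
    push_cast; ring
  · obtain rfl : g = 6 := by omega
    convert modularDefect_atkinLehner_odd (f := 13) (g := 3) (p := true) (by simp) hd hτ using 2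
    push_cast; ring
  · obtain rfl : g = 3 := by omega
    convert modularDefect_atkinLehner_even (f := 13) (g := 3) (p := true) (by simp) hd hτ using 2
    push_cast; ring
  · obtain rfl : g = 2 := by omega
    convert modularDefect_atkinLehner_odd (f := 39) (g := 1) (p := false) (by simp) hd hτ using 2
    push_cast; ring
  · obtain rfl : g = 1 := by omega
    convert modularDefect_atkinLehner_even (f := 39) (g := 1) (p := false) (by simp) hd hτ using 2
    push_cast; ring

/-! ### Reduction theory: moving points away from the real axis. -/

/-- Let r/m be a Dirichlet approximation of Re τ with m ≤ 20. The Atkin-Lehner map of index e =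
78/gcd(m, 78) sending r/m to ∞ divides the height by e|mτ - r|², and 78((1/21)² + (1/16)²) < 1/2. -/
theorem exists_modularDefect_eq_im_ge_two_mul {τ : ℂ} (hτ : 0 < τ.im) (hlt : τ.im < 1 / 320) :
    ∃ τ' : ℂ, 2 * τ.im ≤ τ'.im ∧ modularDefect τ' = modularDefect τ := by
  obtain ⟨x, hx, hm⟩ := Real.exists_rat_abs_sub_le_and_den_le τ.re (n := 20) (by norm_num)
  set m := x.den with hm_def
  have hm0 : 0 < m := x.den_pos
  set g := Nat.gcd m 78
  have hg0 : 0 < g := Nat.gcd_pos_of_pos_right _ (by norm_num)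
  obtain ⟨m', hm'⟩ : g ∣ m := Nat.gcd_dvd_left _ _
  obtain ⟨e, he⟩ : g ∣ 78 := Nat.gcd_dvd_right _ _
  have hcop1 : Nat.Coprime m' e := by
    have := Nat.coprime_div_gcd_div_gcd (m := m) (n := 78) hg0
    rwa [show m / Nat.gcd m 78 = m' from Nat.div_eq_of_eq_mul_right hg0 hm',
      show 78 / Nat.gcd m 78 = e from Nat.div_eq_of_eq_mul_right hg0 he] at this
  -- This uses that 78 is squarefree.
  have hcop2 : Nat.Coprime g e := by
    have hg : g ∈ Nat.divisors 78 := Nat.mem_divisors.2 ⟨Dvd.intro _ he.symm, by norm_num⟩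
    rw [show Nat.divisors 78 = {1, 2, 3, 6, 13, 26, 39, 78} by decide] at hg
    simp only [Finset.mem_insert, Finset.mem_singleton] at hg
    generalize g = g' at *
    rcases hg with rfl | rfl | rfl | rfl | rfl | rfl | rfl | rfl
    · exact Nat.coprime_one_left e
    · obtain rfl : e = 39 := by omega
      norm_num
    · obtain rfl : e = 26 := by omega
      norm_num
    · obtain rfl : e = 13 := by omega
      norm_num
    · obtain rfl : e = 6 := by omega
      norm_num
    · obtain rfl : e = 3 := by omega
      norm_num
    · obtain rfl : e = 2 := by omega
      norm_num
    · obtain rfl : e = 1 := by omega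
      norm_num
  have he78 : e ≤ 78 := Nat.le_of_dvd (by norm_num) (Dvd.intro_left _ he.symm)
  have he0 : 0 < e := Nat.pos_of_ne_zero (by rintro rfl; simp at he)
  have hcop3 : IsCoprime ((e : ℤ) * (-x.num)) (m : ℤ) := by
    refine IsCoprime.mul_left ?_ ?_
    · rw [hm']
      exact Nat.isCoprime_iff_coprime.2 (Nat.Coprime.mul_right hcop2.symm hcop1.symm)
    · refine IsCoprime.neg_left ?_
      rw [Int.isCoprime_iff_gcd_eq_one]
      exact x.reduced
  obtain ⟨a, b, hab⟩ := hcop3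
  have hdet : (e : ℤ) * (a * (-x.num)) - g * (-b * m') = 1 := by
    have : (m : ℤ) = g * m' := by exact_mod_cast hm'
    rw [this] at hab
    linear_combination hab
  have heg : e * g = 78 := by rw [mul_comm]; exact he.symm
  have hegZ : (e : ℤ) * g = 78 := by exact_mod_cast heg
  refine ⟨_, ?_, modularDefect_atkinLehner heg hdet hτ⟩
  rw [mobius_im]
  have hdet2 : (e : ℤ) * a * (e * -x.num) - -b * (78 * m') = e := by
    rw [← hegZ]
    linear_combination (e : ℤ) * hdet
  have hden : (((78 * m' : ℤ) : ℂ) * τ + ((e * -x.num : ℤ) : ℂ)) =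
      (e : ℂ) * ((m : ℂ) * τ - x.num) := by
    have h1 : (78 : ℂ) = e * g := by exact_mod_cast heg.symm
    have h2 : (m : ℂ) = g * m' := by exact_mod_cast hm'
    rw [h2]
    push_cast
    rw [h1]
    ring
  rw [hdet2, hden, Complex.normSq_mul, Complex.normSq_natCast]
  have hmR : (0 : ℝ) < m := by exact_mod_cast hm0
  have hm20 : (m : ℝ) ≤ 20 := by exact_mod_cast hm
  have heR : (0 : ℝ) < e := by exact_mod_cast he0
  have he78R : (e : ℝ) ≤ 78 := by exact_mod_cast he78
  have hN : Complex.normSq ((m : ℂ) * τ - x.num) =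
      (m * τ.re - x.num) ^ 2 + (m * τ.im) ^ 2 := by
    rw [Complex.normSq_apply]
    simp
    ring
  have hx' : |(m : ℝ) * τ.re - x.num| ≤ 1 / 21 := by
    have h1 : (m : ℝ) * τ.re - x.num = m * (τ.re - x) := by
      rw [mul_sub]
      congr 1
      rw [hm_def, mul_comm]
      exact_mod_cast (Rat.mul_den_eq_num x).symm
    rw [h1, abs_mul, abs_of_pos hmR]
    calc (m : ℝ) * |τ.re - x| ≤ m * (1 / (((20 : ℕ) + 1) * m)) := by gcongr
      _ = 1 / 21 := by field_simp; norm_num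
  have hN1 : ((m : ℝ) * τ.re - x.num) ^ 2 ≤ (1 / 21) ^ 2 := by
    rw [← sq_abs]
    gcongr
  have hN2 : ((m : ℝ) * τ.im) ^ 2 ≤ (20 * (1 / 320)) ^ 2 := by
    gcongr
  have hpos : 0 < Complex.normSq ((m : ℂ) * τ - x.num) := by
    rw [hN]
    positivity
  have hle : (e : ℝ) * Complex.normSq ((m : ℂ) * τ - x.num) ≤ 1 / 2 := by
    rw [hN]
    calc (e : ℝ) * (((m : ℝ) * τ.re - x.num) ^ 2 + ((m : ℝ) * τ.im) ^ 2)
        ≤ 78 * ((1 / 21) ^ 2 + (20 * (1 / 320)) ^ 2) := by gcongr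
      _ ≤ 1 / 2 := by norm_num
  rw [le_div_iff₀ (by positivity)]
  push_cast
  nlinarith [mul_le_mul_of_nonneg_left hle (mul_pos heR hτ).le]

theorem exists_modularDefect_eq_im_ge {τ : ℂ} (hτ : 0 < τ.im) :
    ∃ τ' : ℂ, 1 / 320 ≤ τ'.im ∧ modularDefect τ' = modularDefect τ := by
  obtain ⟨n, hn⟩ := pow_unbounded_of_one_lt (1 / 320 / τ.im) (one_lt_two)
  rw [div_lt_iff₀ hτ] at hn
  induction n generalizing τ with
  | zero => exact ⟨τ, by linarith, rfl⟩
  | succ n ih =>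
    by_cases hlt : τ.im < 1 / 320
    · obtain ⟨τ', h1, h2⟩ := exists_modularDefect_eq_im_ge_two_mul hτ hlt
      obtain ⟨τ'', h3, h4⟩ := ih (τ := τ') (by linarith) (by
        rw [pow_succ] at hn
        have : (2 : ℝ) ^ n * (2 * τ.im) ≤ 2 ^ n * τ'.im := by gcongr
        linarith)
      exact ⟨τ'', h3, h4.trans h2⟩
    · exact ⟨τ, not_lt.1 hlt, rfl⟩

/-! ### Expansions in q at the cusp. -/

/-- Euler's product `∏ (1 - q ^ n)`. -/
noncomputable def eulerProduct (q : ℂ) : ℂ := ∏' n : ℕ, (1 - q ^ (n + 1))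

theorem differentiableOn_eulerProduct : DifferentiableOn ℂ eulerProduct (Metric.ball 0 1) :=
  ModularForm.differentiableOn_tprod_one_sub_pow

theorem one_sub_pow_ne_zero {q : ℂ} (hq : ‖q‖ < 1) {n : ℕ} (hn : n ≠ 0) : 1 - q ^ n ≠ 0 := by
  intro h
  have h1 : ‖q ^ n‖ = 1 := by rw [← sub_eq_zero.1 h, norm_one]
  rw [norm_pow] at h1
  exact (pow_lt_one₀ (norm_nonneg q) hq hn).ne h1

theorem eulerProduct_ne_zero {q : ℂ} (hq : ‖q‖ < 1) : eulerProduct q ≠ 0 := by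
  unfold eulerProduct
  simp only [sub_eq_add_neg]
  refine tprod_one_add_ne_zero_of_summable (f := fun n : ℕ => -q ^ (n + 1)) ?_ ?_
  · intro i
    simpa [sub_eq_add_neg] using one_sub_pow_ne_zero hq (Nat.succ_ne_zero i)
  · simpa using (summable_nat_add_iff 1).mpr (summable_geometric_of_lt_one (norm_nonneg _) hq)

theorem eulerProduct_zero : eulerProduct 0 = 1 := by
  simp [eulerProduct]

theorem hasDerivAt_eulerProduct_zero : HasDerivAt eulerProduct (-1) 0 := by
  have hmem : (0 : ℂ) ∈ Metric.ball (0 : ℂ) 1 := Metric.mem_ball_self one_pos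
  have hd : DifferentiableAt ℂ eulerProduct 0 :=
    differentiableOn_eulerProduct.differentiableAt (Metric.isOpen_ball.mem_nhds hmem)
  -- At 0 only the factor 1 - q has a nonzero logarithmic derivative.
  have hl : ∀ n : ℕ, logDeriv (fun q : ℂ => 1 - q ^ (n + 1)) 0 = if n = 0 then -1 else 0 := by
    intro n
    have : HasDerivAt (fun q : ℂ => 1 - q ^ (n + 1)) (-(((n + 1 : ℕ) : ℂ) * 0 ^ n)) 0 := by
      simpa using (hasDerivAt_pow (n + 1) (0 : ℂ)).const_sub 1
    rw [logDeriv_apply, this.deriv]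
    rcases n with _ | n <;> simp
  have h := logDeriv_tprod_eq_tsum Metric.isOpen_ball hmem
    (f := fun (n : ℕ) (q : ℂ) => 1 - q ^ (n + 1)) (by intro i; simp) (by intro i; fun_prop)
    (by
      simp only [hl]
      exact (hasSum_ite_eq 0 (-1 : ℂ)).summable)
    ModularForm.multipliableLocallyUniformlyOn_one_sub_pow
    (eulerProduct_ne_zero (by simp))
  simp only [hl, tsum_ite_eq] at h
  have h' : logDeriv eulerProduct 0 = -1 := h
  rw [logDeriv_apply, eulerProduct_zero, div_one] at h'
  rw [← h']
  exact hd.hasDerivAt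

/-- The function of `q` such that `t = P(q) / q`. -/
noncomputable def tSeries (q : ℂ) : ℂ :=
  eulerProduct (q ^ 3) * eulerProduct (q ^ 13) / (eulerProduct q * eulerProduct (q ^ 39))

theorem norm_pow_lt_one {q : ℂ} (hq : ‖q‖ < 1) {n : ℕ} (hn : n ≠ 0) : ‖q ^ n‖ < 1 := by
  rw [norm_pow]
  exact pow_lt_one₀ (norm_nonneg q) hq hn

theorem tSeries_ne_zero {q : ℂ} (hq : ‖q‖ < 1) : tSeries q ≠ 0 :=
  div_ne_zero (mul_ne_zero (eulerProduct_ne_zero (norm_pow_lt_one hq (by norm_num)))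
    (eulerProduct_ne_zero (norm_pow_lt_one hq (by norm_num))))
    (mul_ne_zero (eulerProduct_ne_zero hq)
      (eulerProduct_ne_zero (norm_pow_lt_one hq (by norm_num))))

theorem mapsTo_pow_ball {n : ℕ} (hn : n ≠ 0) :
    Set.MapsTo (fun q : ℂ => q ^ n) (Metric.ball 0 1) (Metric.ball 0 1) := by
  intro q hq
  rw [mem_ball_zero_iff] at hq ⊢
  exact norm_pow_lt_one hq hn

theorem differentiableOn_comp_pow {f : ℂ → ℂ} (hf : DifferentiableOn ℂ f (Metric.ball 0 1))
    {n : ℕ} (hn : n ≠ 0) : DifferentiableOn ℂ (fun q => f (q ^ n)) (Metric.ball 0 1) :=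
  hf.comp (by fun_prop) (mapsTo_pow_ball hn)

theorem differentiableOn_tSeries : DifferentiableOn ℂ tSeries (Metric.ball 0 1) := by
  have h := differentiableOn_eulerProduct
  refine DifferentiableOn.div ((differentiableOn_comp_pow h (by norm_num)).mul
    (differentiableOn_comp_pow h (by norm_num)))
    (h.mul (differentiableOn_comp_pow h (by norm_num))) ?_
  intro q hq
  rw [mem_ball_zero_iff] at hq
  exact mul_ne_zero (eulerProduct_ne_zero hq)
    (eulerProduct_ne_zero (norm_pow_lt_one hq (by norm_num)))

theorem tSeries_zero : tSeries 0 = 1 := by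
  simp [tSeries, eulerProduct_zero]

theorem deriv_tSeries_zero : deriv tSeries 0 = 1 := by
  have h := hasDerivAt_eulerProduct_zero
  have hp : ∀ n : ℕ, HasDerivAt (fun q : ℂ => eulerProduct (q ^ (n + 2))) 0 0 := by
    intro n
    have h1 : HasDerivAt eulerProduct (-1) ((0 : ℂ) ^ (n + 2)) := by simpa using h
    refine (HasDerivAt.comp (0 : ℂ) h1 (hasDerivAt_pow (n + 2) (0 : ℂ))).congr_deriv ?_
    simp
  have h2 := ((hp 1).mul (hp 11)).div (h.mul (hp 37)) (by simp [eulerProduct_zero])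
  have h3 := h2.deriv
  simp [eulerProduct_zero] at h3
  exact h3

/-- The nome `q = exp(2πiτ)`. -/
noncomputable def nome (τ : ℂ) : ℂ := Complex.exp (2 * (Real.pi : ℂ) * Complex.I * τ)

theorem nome_ne_zero (τ : ℂ) : nome τ ≠ 0 := Complex.exp_ne_zero _

theorem norm_nome (τ : ℂ) : ‖nome τ‖ = Real.exp (-(2 * Real.pi * τ.im)) := by
  rw [nome, Complex.norm_exp]
  congr 1
  simp

theorem norm_nome_lt_one {τ : ℂ} (hτ : 0 < τ.im) : ‖nome τ‖ < 1 := by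
  rw [norm_nome, Real.exp_lt_one_iff]
  have := Real.pi_pos
  have : 0 < 2 * Real.pi * τ.im := by positivity
  linarith

theorem nome_natCast_mul (n : ℕ) (τ : ℂ) : nome (n * τ) = nome τ ^ n := by
  rw [nome, nome, ← Complex.exp_nat_mul]
  congr 1
  ring

theorem exists_nome_eq {q : ℂ} (hq0 : q ≠ 0) (hq : ‖q‖ < 1) : ∃ τ : ℂ, 0 < τ.im ∧ nome τ = q := by
  refine ⟨Complex.log q / (2 * (Real.pi : ℂ) * Complex.I), ?_, ?_⟩
  · by_contra h
    rw [not_lt] at h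
    have h1 : ‖nome (Complex.log q / (2 * (Real.pi : ℂ) * Complex.I))‖ = ‖q‖ := by
      rw [nome, mul_div_cancel₀ _ Complex.two_pi_I_ne_zero, Complex.exp_log hq0]
    rw [norm_nome] at h1
    have h2 : Real.exp 0 ≤ ‖q‖ := by
      rw [← h1, Real.exp_le_exp]
      have := mul_nonneg Real.two_pi_pos.le (neg_nonneg.2 h)
      linarith
    rw [Real.exp_zero] at h2
    linarith
  · rw [nome, mul_div_cancel₀ _ Complex.two_pi_I_ne_zero, Complex.exp_log hq0]

theorem tGamma_eq_tSeries_div (τ : ℂ) : tGamma τ = tSeries (nome τ) / nome τ := by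
  have he : ∀ l : ℕ, etaScaled l τ =
      Complex.exp (2 * Real.pi * Complex.I * (l * τ) / 24) * eulerProduct (nome τ ^ l) := by
    intro l
    unfold etaScaled ModularForm.eta eulerProduct
    simp only [ModularForm.eta_q_eq_pow]
    rw [← nome_natCast_mul]
    congr 1
  unfold tGamma tSeries
  simp only [he, pow_one]
  have hsplit : ∀ a b c d x y z w : ℂ,
      a * x * (b * y) / (c * z * (d * w)) = x * y / (z * w) * (a * b / (c * d)) := by
    intro a b c d x y z w
    simp only [div_eq_mul_inv, mul_inv]
    ring
  rw [hsplit, ← Complex.exp_add, ← Complex.exp_add, ← Complex.exp_sub, div_eq_mul_inv _ (nome τ),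
    nome, ← Complex.exp_neg]
  congr 2
  push_cast
  ring

/-- The regular part of `t` at the cusp: `t = 1 / q + tRegular q`. -/
noncomputable def tRegular : ℂ → ℂ := dslope tSeries 0

/-- The function `k` such that `t = 1 / q + 1 + q k(q)`. -/
noncomputable def tTail : ℂ → ℂ := dslope tRegular 0

theorem differentiableOn_tRegular : DifferentiableOn ℂ tRegular (Metric.ball 0 1) :=
  (Complex.differentiableOn_dslope (Metric.ball_mem_nhds 0 one_pos)).2 differentiableOn_tSeries

theorem differentiableOn_tTail : DifferentiableOn ℂ tTail (Metric.ball 0 1) :=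
  (Complex.differentiableOn_dslope (Metric.ball_mem_nhds 0 one_pos)).2 differentiableOn_tRegular

theorem tSeries_eq_tRegular (q : ℂ) : tSeries q = 1 + q * tRegular q := by
  have := sub_smul_dslope tSeries 0 q
  rw [sub_zero, smul_eq_mul, tSeries_zero] at this
  rw [tRegular, this]
  ring

theorem tRegular_eq_tTail (q : ℂ) : tRegular q = 1 + q * tTail q := by
  have := sub_smul_dslope tRegular 0 q
  have h0 : tRegular 0 = 1 := by rw [tRegular, dslope_same, deriv_tSeries_zero]
  rw [sub_zero, smul_eq_mul, h0] at this
  rw [tTail, this]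
  ring

theorem tSeries_eq_tTail (q : ℂ) : tSeries q = 1 + q + q ^ 2 * tTail q := by
  rw [tSeries_eq_tRegular, tRegular_eq_tTail]
  ring

/-! ### Vanishing of the defect. -/

/-- `modularDefect` as a function of the nome. -/
noncomputable def defectSeries (q : ℂ) : ℂ :=
  q * (tSeries (q ^ 2) ^ 2 * (2 - 2 * tTail q + q ^ 2 * tTail (q ^ 2) - q ^ 2 * tTail q ^ 2) +
    q * tSeries q ^ 3 + 2 * tSeries (q ^ 2) * tSeries q ^ 2 - q * tSeries q * tSeries (q ^ 2)) ^ 2 /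
    (tSeries q * tSeries (q ^ 2)) ^ 3

/-- With s = t(2τ), the polar parts of s and t² - 2t agree, so s²(s - t² + 2t) is O(q⁻⁴), as are the
other terms. The square is O(q⁻⁸), and dividing by (ts)³ ~ q⁻⁹ leaves a factor q. -/
theorem modularDefect_eq_defectSeries (τ : ℂ) : modularDefect τ = defectSeries (nome τ) := by
  have h2 : nome (2 * τ) = nome τ ^ 2 := by exact_mod_cast nome_natCast_mul 2 τ
  unfold modularDefect modularPolyNorm modularPoly defectSeries
  rw [tGamma_eq_tSeries_div, tGamma_eq_tSeries_div, h2]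
  have hq := nome_ne_zero τ
  generalize nome τ = q at *
  have e1 := tSeries_eq_tTail q
  have e2 := tSeries_eq_tTail (q ^ 2)
  have key : q ^ 2 * (2 - 2 * tTail q + q ^ 2 * tTail (q ^ 2) - q ^ 2 * tTail q ^ 2) =
      tSeries (q ^ 2) - tSeries q ^ 2 + 2 * q * tSeries q := by
    rw [e1, e2]
    ring
  generalize 2 - 2 * tTail q + q ^ 2 * tTail (q ^ 2) - q ^ 2 * tTail q ^ 2 = r at *
  have hr : r = (tSeries (q ^ 2) - tSeries q ^ 2 + 2 * q * tSeries q) / q ^ 2 := by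
    rw [← key, mul_div_cancel_left₀ _ (pow_ne_zero 2 hq)]
  rw [hr]
  generalize tSeries (q ^ 2) = s
  generalize tSeries q = t
  rw [show t / q * (s / q ^ 2) = t * s / q ^ 3 by rw [div_mul_div_comm]; ring, div_pow (t * s),
    div_div_eq_mul_div]
  congr 1
  field_simp
  ring

theorem differentiableOn_defectSeries : DifferentiableOn ℂ defectSeries (Metric.ball 0 1) := by
  have h1 := differentiableOn_tSeries
  have h2 := differentiableOn_comp_pow h1 (n := 2) (by norm_num)
  have h3 := differentiableOn_tTail
  have h4 := differentiableOn_comp_pow h3 (n := 2) (by norm_num)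
  refine DifferentiableOn.div (by fun_prop) (by fun_prop) ?_
  intro q hq
  rw [mem_ball_zero_iff] at hq
  exact pow_ne_zero _ (mul_ne_zero (tSeries_ne_zero hq)
    (tSeries_ne_zero (norm_pow_lt_one hq (by norm_num))))

/-- On the unit disc `defectSeries` takes all its values on a smaller closed disc, so by the maximum
principle it equals its value 0 at the centre. -/
theorem modularDefect_eq_zero {τ : ℂ} (hτ : 0 < τ.im) : modularDefect τ = 0 := by
  have hr : Real.exp (-(2 * Real.pi * (1 / 320))) < 1 := by
    rw [Real.exp_lt_one_iff]
    have := Real.pi_pos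
    linarith
  have h := Complex.eq_const_of_exists_le (f := defectSeries) (b := 1)
    differentiableOn_defectSeries (Real.exp_pos _).le hr (by
      intro z hz
      rw [mem_ball_zero_iff] at hz
      by_cases hz0 : z = 0
      · exact ⟨0, by simpa using (Real.exp_pos _).le, by rw [hz0]⟩
      · obtain ⟨σ, hσ, rfl⟩ := exists_nome_eq hz0 hz
        obtain ⟨σ', h1, h2⟩ := exists_modularDefect_eq_im_ge hσ
        refine ⟨nome σ', ?_, ?_⟩
        · rw [mem_closedBall_zero_iff, norm_nome, Real.exp_le_exp]
          have := mul_le_mul_of_nonneg_left h1 Real.two_pi_pos.le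
          linarith
        · rw [← modularDefect_eq_defectSeries, ← modularDefect_eq_defectSeries, h2])
  rw [modularDefect_eq_defectSeries,
    h (by rw [mem_ball_zero_iff]; exact norm_nome_lt_one hτ)]
  simp [defectSeries]

theorem modularPoly_tGamma {τ : ℂ} (hτ : 0 < τ.im) :
    modularPoly (tGamma τ) (tGamma (2 * τ)) = 0 := by
  have h := modularDefect_eq_zero hτ
  unfold modularDefect modularPolyNorm at h
  have hne : (tGamma τ * tGamma (2 * τ)) ^ 3 ≠ 0 :=
    pow_ne_zero _ (mul_ne_zero (tGamma_ne_zero_of_im_pos hτ) (tGamma_ne_zero_of_im_pos (im_ofNat_mul_pos 2 hτ)))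
  exact pow_eq_zero_iff two_ne_zero |>.1 ((div_eq_zero_iff.1 h).resolve_right hne)

/-! ### The product of the three conjugates. -/

theorem multipliable_one_sub_mul_pow (c : ℂ) {x : ℂ} (hx : ‖x‖ < 1) {k l : ℕ} (hk : k ≠ 0) :
    Multipliable fun n : ℕ => 1 - c * x ^ (k * n + l) := by
  simp only [sub_eq_add_neg]
  refine multipliable_one_add_of_summable ?_
  simp only [norm_neg, norm_mul, pow_add, pow_mul, norm_pow]
  refine Summable.mul_left _ (Summable.mul_right _ (summable_geometric_of_lt_one (by positivity) ?_))
  exact pow_lt_one₀ (norm_nonneg _) hx hk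

/-- The product `∏ (1 - c x ^ (2n + 1))`. -/
noncomputable def oddProduct (c x : ℂ) : ℂ := ∏' n : ℕ, (1 - c * x ^ (2 * n + 1))

theorem eulerProduct_eq_mul_oddProduct {x : ℂ} (hx : ‖x‖ < 1) :
    eulerProduct x = oddProduct 1 x * eulerProduct (x ^ 2) := by
  have he : Multipliable fun n : ℕ => 1 - x ^ (2 * n + 1) := by
    simpa using multipliable_one_sub_mul_pow 1 hx (k := 2) (l := 1) two_ne_zero
  have ho : Multipliable fun n : ℕ => 1 - x ^ (2 * n + 1 + 1) := by
    simpa using multipliable_one_sub_mul_pow 1 hx (k := 2) (l := 2) two_ne_zero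
  have h := tprod_even_mul_odd (f := fun n : ℕ => 1 - x ^ (n + 1)) he ho
  unfold eulerProduct oddProduct
  rw [← h]
  simp only [one_mul]
  congr 1
  refine tprod_congr fun n => ?_
  rw [← pow_mul]
  ring_nf

theorem oddProduct_neg (x : ℂ) : oddProduct 1 (-x) = oddProduct (-1) x := by
  unfold oddProduct
  refine tprod_congr fun n => ?_
  rw [Odd.neg_pow ⟨n, rfl⟩]
  ring

theorem oddProduct_mul_neg {x : ℂ} (hx : ‖x‖ < 1) :
    oddProduct 1 x * oddProduct 1 (-x) = oddProduct 1 (x ^ 2) := by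
  rw [oddProduct_neg]
  unfold oddProduct
  rw [← (multipliable_one_sub_mul_pow 1 hx two_ne_zero).tprod_mul
    (multipliable_one_sub_mul_pow (-1) hx two_ne_zero)]
  refine tprod_congr fun n => ?_
  rw [← pow_mul, mul_comm 2 (2 * n + 1), pow_mul]
  ring

/-- Pairing the factors at `x` and `-x` in Euler's product. -/
theorem eulerProduct_mul_neg {x : ℂ} (hx : ‖x‖ < 1) :
    eulerProduct x * eulerProduct (-x) * eulerProduct (x ^ 4) = eulerProduct (x ^ 2) ^ 3 := by
  have hx2 : ‖x ^ 2‖ < 1 := norm_pow_lt_one hx two_ne_zero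
  have h1 := eulerProduct_eq_mul_oddProduct hx
  have h2 := eulerProduct_eq_mul_oddProduct (x := -x) (by rwa [norm_neg])
  have h3 := eulerProduct_eq_mul_oddProduct hx2
  have h4 := oddProduct_mul_neg hx
  rw [neg_sq] at h2
  rw [← pow_mul] at h3
  rw [h1, h2]
  calc _ = oddProduct 1 x * oddProduct 1 (-x) * eulerProduct (x ^ (2 * 2)) *
        eulerProduct (x ^ 2) ^ 2 := by ring
    _ = _ := by rw [h4, ← h3]; ring

theorem tSeries_mul_neg {x : ℂ} (hx : ‖x‖ < 1) :
    tSeries x * tSeries (-x) * tSeries (x ^ 4) = tSeries (x ^ 2) ^ 3 := by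
  have key : ∀ n : ℕ, n ≠ 0 → Odd n → eulerProduct (x ^ n) * eulerProduct ((-x) ^ n) *
      eulerProduct ((x ^ 4) ^ n) = eulerProduct ((x ^ 2) ^ n) ^ 3 := by
    intro n hn hodd
    rw [hodd.neg_pow, ← pow_mul, ← pow_mul, mul_comm 4, mul_comm 2, pow_mul, pow_mul]
    exact eulerProduct_mul_neg (norm_pow_lt_one hx hn)
  have k1 := eulerProduct_mul_neg hx
  have k3 := key 3 (by norm_num) (by decide)
  have k13 := key 13 (by norm_num) (by decide)
  have k39 := key 39 (by norm_num) (by decide)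
  unfold tSeries
  rw [div_pow, mul_pow, mul_pow, ← k1, ← k3, ← k13, ← k39]
  simp only [div_eq_mul_inv, mul_inv]
  ring

theorem nome_add_half (τ : ℂ) : nome (τ + 1 / 2) = -nome τ := by
  rw [nome, mul_add, Complex.exp_add, nome,
    show 2 * (Real.pi : ℂ) * Complex.I * (1 / 2) = Real.pi * Complex.I by ring,
    Complex.exp_pi_mul_I, mul_neg_one]

/-- With x the nome of τ/2, the nomes of τ, 2τ and (τ+1)/2 are x², x⁴ and -x; the last one supplies
the minus sign. -/
theorem tGamma_mul_mul {τ : ℂ} (hτ : 0 < τ.im) :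
    tGamma (2 * τ) * tGamma (τ / 2) * tGamma ((τ + 1) / 2) = -tGamma τ ^ 3 := by
  have hx : ‖nome (τ / 2)‖ < 1 := norm_nome_lt_one (by simpa using hτ)
  have h1 : nome τ = nome (τ / 2) ^ 2 := by
    rw [← nome_natCast_mul]
    congr 1
    push_cast
    ring
  have h2 : nome (2 * τ) = nome (τ / 2) ^ 4 := by
    rw [← nome_natCast_mul]
    congr 1
    push_cast
    ring
  have h3 : nome ((τ + 1) / 2) = -nome (τ / 2) := by
    rw [← nome_add_half, add_div]
  have hq := nome_ne_zero (τ / 2)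
  simp only [tGamma_eq_tSeries_div, h1, h2, h3]
  have h := tSeries_mul_neg hx
  rw [div_pow, ← h]
  field_simp

/-! ### The other symmetric functions. -/

theorem modularPoly_swap (t s : ℂ) : modularPoly s t = modularPoly t s := by
  unfold modularPoly
  ring

/-- Both s and u are roots of one cubic; u times the first equation minus s times the second
eliminates its linear coefficient, and the product relation replaces t³ by -suv. -/
theorem sub_mul_sum_sub_eq_zero_of_modularPoly {t s u v : ℂ} (ht : t ≠ 0)
    (h : modularPoly t s = 0) (hu : modularPoly t u = 0) (hprod : s * u * v = -t ^ 3) :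
    (s - u) * (s + u + v - (t ^ 2 - 2 * t)) = 0 := by
  have hne : s * u ≠ 0 := left_ne_zero_of_mul (b := v) (by
    rw [hprod]
    exact neg_ne_zero.2 (pow_ne_zero 3 ht))
  refine (mul_eq_zero.1 (?_ : s * u * ((s - u) * (s + u + v - (t ^ 2 - 2 * t))) = 0)).resolve_left
    hne
  unfold modularPoly at h hu
  linear_combination u * h - s * hu + (s - u) * hprod

/-- Otherwise P(q⁴) = q³P(q) for P = `tSeries` on the punctured disc, and q → 0 gives 1 = 0. -/
theorem exists_tGamma_two_mul_ne : ∃ τ : ℂ, 0 < τ.im ∧ tGamma (2 * τ) - tGamma (τ / 2) ≠ 0 := by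
  by_contra! hcon
  have hq : ∀ q : ℂ, q ≠ 0 → ‖q‖ < 1 → tSeries (q ^ 4) - q ^ 3 * tSeries q = 0 := by
    intro q hq0 hq1
    obtain ⟨σ, hσ, rfl⟩ := exists_nome_eq hq0 hq1
    have h := hcon (2 * σ) (im_ofNat_mul_pos 2 hσ)
    rw [mul_div_cancel_left₀ _ two_ne_zero, show (2 : ℂ) * (2 * σ) = (4 : ℕ) * σ by push_cast; ring,
      tGamma_eq_tSeries_div, tGamma_eq_tSeries_div, nome_natCast_mul] at h
    generalize nome σ = q at *
    field_simp at h
    linear_combination h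
  have hd : DifferentiableOn ℂ (fun q => tSeries (q ^ 4) - q ^ 3 * tSeries q)
      (Metric.ball 0 1) := by
    have h1 := differentiableOn_tSeries
    have h2 := differentiableOn_comp_pow h1 (n := 4) (by norm_num)
    fun_prop
  have hc := (hd.differentiableAt (Metric.ball_mem_nhds 0 one_pos)).continuousAt
  have hl : Filter.Tendsto (fun q => tSeries (q ^ 4) - q ^ 3 * tSeries q) (nhdsWithin 0 {0}ᶜ)
      (nhds 0) := by
    refine tendsto_const_nhds.congr' ?_
    filter_upwards [self_mem_nhdsWithin,
      mem_nhdsWithin_of_mem_nhds (Metric.ball_mem_nhds (0 : ℂ) one_pos)] with q h1 h2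
    exact (hq q h1 (mem_ball_zero_iff.1 h2)).symm
  have := tendsto_nhds_unique (hc.tendsto.mono_left nhdsWithin_le_nhds) hl
  simp [tSeries_zero] at this

theorem tGamma_sum {τ : ℂ} (hτ : 0 < τ.im) :
    tGamma (2 * τ) + tGamma (τ / 2) + tGamma ((τ + 1) / 2) = tGamma τ ^ 2 - 2 * tGamma τ := by
  let U : Set ℂ := {z | 0 < z.im}
  have hUo : IsOpen U := isOpen_lt continuous_const Complex.continuous_im
  have hUc : IsPreconnected U := (convex_halfSpace_im_gt 0).isPreconnected
  have d0 : DifferentiableOn ℂ tGamma U := fun z hz =>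
    (differentiableAt_tGamma hz).differentiableWithinAt
  have d1 : DifferentiableOn ℂ (fun z => tGamma (2 * z)) U :=
    d0.comp (by fun_prop) (fun z hz => im_ofNat_mul_pos 2 hz)
  have d2 : DifferentiableOn ℂ (fun z => tGamma (z / 2)) U :=
    d0.comp (by fun_prop) (fun z hz => by simpa [U] using hz)
  have d3 : DifferentiableOn ℂ (fun z => tGamma ((z + 1) / 2)) U :=
    d0.comp (by fun_prop) (fun z hz => by simpa [U] using hz)
  have hmul : ∀ z ∈ U, (tGamma (2 * z) - tGamma (z / 2)) *
      (tGamma (2 * z) + tGamma (z / 2) + tGamma ((z + 1) / 2) -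
        (tGamma z ^ 2 - 2 * tGamma z)) = 0 := by
    intro z hz
    have h := modularPoly_tGamma (τ := z / 2) (by simpa [U] using hz)
    rw [mul_div_cancel₀ _ two_ne_zero, ← modularPoly_swap] at h
    exact sub_mul_sum_sub_eq_zero_of_modularPoly (tGamma_ne_zero_of_im_pos hz) (modularPoly_tGamma hz) h
      (tGamma_mul_mul hz)
  -- Analytic functions on a connected open set have no zero divisors, so points where t(2τ) =
  -- t(τ/2) do no harm.
  rcases AnalyticOnNhd.eq_zero_or_eq_zero_of_mul_eq_zero
    ((d1.sub d2).analyticOnNhd hUo)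
    ((((d1.add d2).add d3).sub ((d0.pow 2).sub (d0.const_mul 2))).analyticOnNhd hUo) hmul hUc
    with h | h
  · obtain ⟨σ, hσ, hne⟩ := exists_tGamma_two_mul_ne
    exact absurd (h σ hσ) hne
  · exact sub_eq_zero.1 (h τ hτ)

theorem tGamma_sum_mul {τ : ℂ} (hτ : 0 < τ.im) :
    tGamma (2 * τ) * tGamma (τ / 2) + tGamma (2 * τ) * tGamma ((τ + 1) / 2) +
      tGamma (τ / 2) * tGamma ((τ + 1) / 2) = 2 * tGamma τ ^ 2 - tGamma τ := by
  have h := modularPoly_tGamma hτ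
  have h1 := tGamma_sum hτ
  have h3 := tGamma_mul_mul hτ
  unfold modularPoly at h
  refine mul_left_cancel₀ (tGamma_ne_zero_of_im_pos (im_ofNat_mul_pos 2 hτ)) ?_
  linear_combination -h + tGamma (2 * τ) ^ 2 * h1 + h3

/-! ### Behaviour at ∞ and the conclusion. -/

theorem isBigO_tGamma_sub :
    (fun τ : ℂ => tGamma τ - 1 / Complex.exp (2 * (Real.pi : ℂ) * Complex.I * τ))
      =O[Filter.comap Complex.im Filter.atTop] (fun _ : ℂ => (1 : ℂ)) := by
  have hlim : Filter.Tendsto nome (Filter.comap Complex.im Filter.atTop) (nhds 0) := by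
    rw [tendsto_zero_iff_norm_tendsto_zero]
    simp only [norm_nome]
    refine Real.tendsto_exp_neg_atTop_nhds_zero.comp ?_
    exact Filter.Tendsto.const_mul_atTop Real.two_pi_pos Filter.tendsto_comap
  have hc : ContinuousAt tRegular 0 := (differentiableOn_tRegular.differentiableAt
    (Metric.ball_mem_nhds 0 one_pos)).continuousAt
  have h := (hc.tendsto.comp hlim).isBigO_one ℂ
  refine h.congr_left fun τ => ?_
  change tRegular (nome τ) = tGamma τ - 1 / nome τ
  rw [tGamma_eq_tSeries_div, tSeries_eq_tRegular]
  have := nome_ne_zero τ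
  field_simp
  ring

theorem theorem3p2 :
    -- `t_Γ = 1/q + O(1)` as `Im τ → ∞`
    ((fun τ : ℂ => tGamma τ - 1 / Complex.exp (2 * (Real.pi : ℂ) * Complex.I * τ))
      =O[Filter.comap Complex.im Filter.atTop] (fun _ : ℂ => (1 : ℂ))) ∧
    ∀ τ : ℂ, 0 < τ.im →
      -- the modular equation, an identity of polynomials in `Y` over `ℂ`
      (Psi2.map (Polynomial.evalRingHom (xGamma τ)) =
        (Polynomial.X - Polynomial.C (xGamma (2 * τ))) *
          (Polynomial.X - Polynomial.C (xGamma (τ / 2))) *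
          (Polynomial.X - Polynomial.C (xGamma ((τ + 1) / 2)))) ∧
      -- the elementary symmetric functions of the three values of `t_Γ`
      (tGamma (2 * τ) + tGamma (τ / 2) + tGamma ((τ + 1) / 2) =
        tGamma τ ^ 2 - 2 * tGamma τ) ∧
      (tGamma (2 * τ) * tGamma (τ / 2) + tGamma (2 * τ) * tGamma ((τ + 1) / 2) +
          tGamma (τ / 2) * tGamma ((τ + 1) / 2) =
        2 * tGamma τ ^ 2 - tGamma τ) ∧
      (tGamma (2 * τ) * tGamma (τ / 2) * tGamma ((τ + 1) / 2) = -tGamma τ ^ 3) := by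
  refine ⟨isBigO_tGamma_sub, fun τ hτ => ⟨?_, tGamma_sum hτ, tGamma_sum_mul hτ,
    tGamma_mul_mul hτ⟩⟩
  have h1 := tGamma_sum hτ
  have h2 := tGamma_sum_mul hτ
  have h3 := tGamma_mul_mul hτ
  have ht := tGamma_ne_zero_of_im_pos hτ
  have hs := tGamma_ne_zero_of_im_pos (im_ofNat_mul_pos 2 hτ)
  have hu := tGamma_ne_zero_of_im_pos (τ := τ / 2) (by simpa using hτ)
  have hv := tGamma_ne_zero_of_im_pos (τ := (τ + 1) / 2) (by simpa using hτ)
  unfold xGamma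
  generalize tGamma (2 * τ) = s at *
  generalize tGamma (τ / 2) = u at *
  generalize tGamma ((τ + 1) / 2) = v at *
  generalize tGamma τ = t at *
  -- Reciprocals exchange the first and second symmetric functions, up to division by the product
  -- -t³.
  have e1 : 1 / s + 1 / u + 1 / v = -(2 * (1 / t) - (1 / t) ^ 2) := by
    field_simp
    linear_combination t ^ 2 * h2 - (1 - 2 * t) * h3
  have e2 : 1 / s * (1 / u) + 1 / s * (1 / v) + 1 / u * (1 / v) =
      -(1 / t) + 2 * (1 / t) ^ 2 := by
    field_simp
    linear_combination t ^ 2 * h1 - (2 - t) * h3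
  have e3 : 1 / s * (1 / u) * (1 / v) = -(1 / t) ^ 3 := by
    field_simp
    linear_combination h3
  generalize 1 / s = a at *
  generalize 1 / u = b at *
  generalize 1 / v = c at *
  generalize 1 / t = x at *
  have c1 := congrArg (C : ℂ → ℂ[X]) e1
  have c2 := congrArg (C : ℂ → ℂ[X]) e2
  have c3 := congrArg (C : ℂ → ℂ[X]) e3
  simp only [Psi2, Polynomial.map_add, Polynomial.map_mul, Polynomial.map_pow, map_X, map_C,
    coe_evalRingHom, eval_add, eval_sub, eval_neg, eval_mul, eval_pow, eval_X, eval_ofNat]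
  simp only [map_add, map_sub, map_neg, map_mul, map_pow] at c1 c2 c3 ⊢
  linear_combination X ^ 2 * c1 - X * c2 + c3
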